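/- Let $K$ be a field of characteristic zero. Let $\mathrm{NSym}=K\langle\Lambda_1,\Lambda_2,\dots\rangle$ be the algebra of noncommutative symmetric functions, $\Lambda_0=1$, and let $S_n$ be defined by $\sum_{n\ge0}S_nt^n=\bigl(\sum_{n\ge0}\Lambda_n(-t)^n\bigr)^{-1}$. For a composition $I=i_1\cdots i_l\vDash n$ put $\Lambda^I=\Lambda_{i_1}\cdots\Lambda_{i_l}$, $S^I=S_{i_1}\cdots S_{i_l}$, $\varepsilon^I=(-1)^{n-l}$ and $m^I=2^{m_1(I)}$, where $m_1(I)$ is the number of parts of $I$ equal to $1$. The ribbon Schur function $R_I$ is defined by $\varepsilon^I R_I=\sum_J\varepsilon^J S^J$, summed over all compositions $J$ of $n$ that $I$ refines. Let $\rho$ be the $K$-algebra homomorphism from $\mathrm{NSym}$ to the ring of symmetric functions over $K$ with $\rho(\Lambda_k)=e_k$. For $n\ge1$ let $X_{P_n}$ be the chromatic symmetric function of the path $P_n$ on $n$ vertices. There are unique symmetric functions $A_{n-1}$ and $B_n$ over $\mathbb Z$ such that $$X_{P_n}=e_1A_{n-1}+B_n$$ and $B_n$ is a $\mathbb Z$-linear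 combination of those $e_\lambda$, $\lambda\vdash n$, for which $\lambda$ has no part equal to $1$. Let $\mathcal C_n$ be the set of compositions of $n$ in which every part is $1$ or $2$ and the last part is $1$. Define $$\widetilde A_n=\sum_{I=i_1\cdots i_l\vDash n}(i_1-1)\cdots(i_l-1)\Lambda^I,\qquad \widetilde B_n=\frac12\sum_{I=12\cdots\in\mathcal C_n}m^IR_I+\frac38\sum_{I=11\cdots\in\mathcal C_n}m^IR_I,$$ where $I=1x\cdots$ means that $I$ begins with the parts $1,x$. Then $A_n=\rho(\widetilde A_n)$ for every $n\ge0$, and $B_n=\rho(\widetilde B_n)$ for every $n\ge1$ with $n\ne2$. For $n=2$ one has $B_2=\rho(2R_{11})$ instead. -/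

import Mathlib

noncomputable section

namespace PathAnalog

/-! ### Commutative symmetric functions -/

/-- The ring of symmetric functions over `R`: power series of bounded degree in the variables
`x_0, x_1, x_2, …` that are fixed by every permutation of the variables. -/
def Sym (R : Type*) [CommRing R] : Subalgebra R (MvPowerSeries ℕ R) where
  carrier := {f | (∃ N : ℕ, ∀ d, MvPowerSeries.coeff d f ≠ 0 → d.degree ≤ N) ∧
    ∀ π : Equiv.Perm ℕ, MvPowerSeries.renameEquiv R π f = f}
  mul_mem' := by
    rintro f g ⟨⟨N, hN⟩, hf⟩ ⟨⟨M, hM⟩, hg⟩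
    refine ⟨⟨N + M, fun d hd => ?_⟩, fun π => by rw [map_mul, hf, hg]⟩
    rw [MvPowerSeries.coeff_mul] at hd
    obtain ⟨p, hp, hne⟩ := Finset.exists_ne_zero_of_sum_ne_zero hd
    rw [← Finset.HasAntidiagonal.mem_antidiagonal.mp hp, map_add]
    exact add_le_add (hN _ (left_ne_zero_of_mul hne)) (hM _ (right_ne_zero_of_mul hne))
  add_mem' := by
    rintro f g ⟨⟨N, hN⟩, hf⟩ ⟨⟨M, hM⟩, hg⟩
    refine ⟨⟨max N M, fun d hd => ?_⟩, fun π => by rw [map_add, hf, hg]⟩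
    by_cases h : MvPowerSeries.coeff d f = 0
    · refine le_max_of_le_right (hM d fun h' => hd ?_)
      rw [map_add, h, h', add_zero]
    · exact le_max_of_le_left (hN d h)
  algebraMap_mem' := by
    classical
    intro r
    refine ⟨⟨0, fun d hd => ?_⟩, fun π => AlgEquiv.commutes _ r⟩
    rw [MvPowerSeries.algebraMap_apply, MvPowerSeries.coeff_C] at hd
    by_cases h : d = 0
    · simp [h]
    · simp [h] at hd

theorem mem_Sym_of_coeff {R : Type*} [CommRing R] {f : MvPowerSeries ℕ R} (N : ℕ)
    (hN : ∀ d, MvPowerSeries.coeff d f ≠ 0 → d.degree ≤ N)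
    (hf : ∀ (π : Equiv.Perm ℕ) (d : ℕ →₀ ℕ),
      MvPowerSeries.coeff (d.mapDomain π) f = MvPowerSeries.coeff d f) : f ∈ Sym R := by
  refine ⟨⟨N, hN⟩, fun π => ?_⟩
  ext d
  obtain ⟨c, rfl⟩ : ∃ c : ℕ →₀ ℕ, c.mapDomain π = d :=
    ⟨d.mapDomain π.symm, by rw [← Finsupp.mapDomain_comp]; simp⟩
  rw [hf]
  have := MvPowerSeries.coeff_embDomain_rename π.toEmbedding f c
  rwa [Finsupp.embDomain_eq_mapDomain] at this

/-- Change of coefficients along a ring homomorphism. -/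
def Sym.map {R S : Type*} [CommRing R] [CommRing S] (φ : R →+* S) (f : Sym R) : Sym S :=
  ⟨MvPowerSeries.map φ f.1, by
    obtain ⟨⟨N, hN⟩, hf⟩ := f.2
    refine ⟨⟨N, fun d hd => hN d fun h => hd ?_⟩, fun π => ?_⟩
    · rw [MvPowerSeries.coeff_map, h, map_zero]
    · have h : MvPowerSeries.rename π f.1 = f.1 := hf π
      change MvPowerSeries.rename π (MvPowerSeries.map φ f.1) = MvPowerSeries.map φ f.1
      rw [MvPowerSeries.rename_map, h]⟩

/-- The elementary symmetric function `e_k`, the sum of all squarefree monomials of degree `k`. -/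
def e (R : Type*) [CommRing R] (k : ℕ) : Sym R := by
  classical
  exact ⟨fun d : ℕ →₀ ℕ => if d.degree = k ∧ ∀ i, d i ≤ 1 then 1 else 0, by
    refine mem_Sym_of_coeff k (fun d hd => ?_) (fun π d => ?_)
    · change (if d.degree = k ∧ ∀ i, d i ≤ 1 then (1 : R) else 0) ≠ 0 at hd
      by_contra h
      exact hd (if_neg fun h' => h h'.1.le)
    · change (if (d.mapDomain π).degree = k ∧ ∀ i, d.mapDomain π i ≤ 1 then (1 : R) else 0) =
        if d.degree = k ∧ ∀ i, d i ≤ 1 then 1 else 0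
      have h1 : (d.mapDomain π).degree = d.degree := Finsupp.degree_mapDomain _ _
      have h2 : (∀ i, d.mapDomain π i ≤ 1) ↔ ∀ i, d i ≤ 1 := by
        rw [← π.forall_congr_right]
        simp only [Finsupp.mapDomain_apply π.injective]
      simp only [h1, h2]⟩

/-- `e_λ = e_{λ_1} e_{λ_2} ⋯` for a partition `λ` of `n`. -/
def ePart (R : Type*) [CommRing R] {n : ℕ} (lam : n.Partition) : Sym R :=
  (lam.parts.map (e R)).prod

/-- The monomial exponent of a colouring: the exponent of `x_i` is the number of vertices of
colour `i`. -/
def content {V : Type*} [Fintype V] (κ : V → ℕ) : ℕ →₀ ℕ :=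
  ∑ v, Finsupp.single (κ v) 1

/-- The chromatic symmetric function `X_G = ∑_κ ∏_v x_{κ(v)}` of a finite graph, the sum being
over all proper colourings `κ`: the coefficient of `x^d` is the (finite) number of proper
colourings with content `d`. -/
def chromaticSym (R : Type*) [CommRing R] {V : Type*} [Fintype V] (G : SimpleGraph V) : Sym R :=
  ⟨fun d : ℕ →₀ ℕ => (Nat.card {κ : G.Coloring ℕ // content κ = d} : R), by
    refine mem_Sym_of_coeff (Fintype.card V) (fun d hd => ?_) (fun π d => ?_)
    · change (Nat.card {κ : G.Coloring ℕ // content κ = d} : R) ≠ 0 at hd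
      have h0 : Nat.card {κ : G.Coloring ℕ // content κ = d} ≠ 0 := fun h =>
        hd (by rw [h, Nat.cast_zero])
      obtain ⟨⟨κ, hκ⟩⟩ := (Nat.card_ne_zero.mp h0).1
      rw [← hκ, content, map_sum]
      simp
    · change (Nat.card {κ : G.Coloring ℕ // content κ = d.mapDomain π} : R) =
        (Nat.card {κ : G.Coloring ℕ // content κ = d} : R)
      have key : ∀ (σ : Equiv.Perm ℕ) (κ : V → ℕ),
          content (fun v => σ (κ v)) = (content κ).mapDomain σ := fun σ κ => by
        rw [content, content, Finsupp.mapDomain_finsetSum]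
        simp only [Finsupp.mapDomain_single]
      congr 1
      symm
      refine Nat.card_congr ⟨
        fun κ => ⟨SimpleGraph.Coloring.mk (fun v => π (κ.1 v))
          (fun h h' => κ.1.valid h (π.injective h')), ?_⟩,
        fun κ => ⟨SimpleGraph.Coloring.mk (fun v => π.symm (κ.1 v))
          (fun h h' => κ.1.valid h (π.symm.injective h')), ?_⟩, ?_, ?_⟩
      · exact (key π κ.1).trans (by rw [κ.2])
      · refine (key π.symm κ.1).trans ?_
        rw [κ.2, ← Finsupp.mapDomain_comp]
        simp
      · intro κ
        ext v
        exact π.symm_apply_apply _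
      · intro κ
        ext v
        exact π.apply_symm_apply _⟩

/-- `X_{P_n}`, where `P_n` is the path on `n` vertices. -/
def pathX (R : Type*) [CommRing R] (n : ℕ) : Sym R :=
  chromaticSym R (SimpleGraph.pathGraph n)

/-- `f` is homogeneous of degree `n` and no `e_λ` with a part `1` (that is, divisible by `e_1`)
occurs in its expansion in the functions `e_λ`. -/
def HasNoE1 {R : Type*} [CommRing R] (n : ℕ) (f : Sym R) : Prop :=
  ∃ c : n.Partition → R, f = ∑ lam, c lam • ePart R lam ∧ ∀ lam, 1 ∈ lam.parts → c lam = 0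

/-- Extraction of the `e_1`-part: `X_{P_{n+1}} = e_1 A + B`, where `B` has no `e_1`-part. -/
def IsPathDecomposition {R : Type*} [CommRing R] (n : ℕ) (A B : Sym R) : Prop :=
  pathX R (n + 1) = e R 1 * A + B ∧ HasNoE1 (n + 1) B

/-! ### Noncommutative symmetric functions -/

/-- `NSym = K⟨Λ_1, Λ_2, …⟩`. -/
abbrev NSym (K : Type*) [Field K] : Type _ := FreeAlgebra K ℕ+

/-- The generators `Λ_k`, `k ≥ 1`, together with `Λ_0 = 1`. -/
def Lam (K : Type*) [Field K] (k : ℕ) : NSym K :=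
  if h : 0 < k then FreeAlgebra.ι K (⟨k, h⟩ : ℕ+) else 1

/-- The complete functions `S_k`, defined by `∑ S_k t^k = 1 / ∑ Λ_k (-t)^k`. -/
def S (K : Type*) [Field K] (k : ℕ) : NSym K :=
  PowerSeries.coeff k
    (PowerSeries.invOfUnit (PowerSeries.mk fun j => (-1 : NSym K) ^ j * Lam K j) 1)

/-- `Λ^I = Λ_{i_1} Λ_{i_2} ⋯`. -/
def LamC (K : Type*) [Field K] {n : ℕ} (I : Composition n) : NSym K :=
  (I.blocks.map (Lam K)).prod

/-- `S^I = S_{i_1} S_{i_2} ⋯`. -/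
def SC (K : Type*) [Field K] {n : ℕ} (I : Composition n) : NSym K :=
  (I.blocks.map (S K)).prod

/-- The sign `ε^I = (-1)^{n - ℓ(I)}` of a composition of `n`. -/
def sgn (K : Type*) [Field K] {n : ℕ} (I : Composition n) : K :=
  (-1) ^ (n - I.length)

/-- The ribbon Schur function: `ε^I R_I = ∑_J ε^J S^J`, over all `J` that `I` refines (the partial
sums of `J` are among those of `I`). -/
def ribbon (K : Type*) [Field K] {n : ℕ} (I : Composition n) : NSym K :=
  sgn K I • ∑ J : Composition n with J.boundaries ⊆ I.boundaries, sgn K J • SC K J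

/-- The projection `ρ : NSym → Sym` that lets the variables commute, `Λ_k ↦ e_k`. -/
def rho (K : Type*) [Field K] : NSym K →ₐ[K] Sym K :=
  FreeAlgebra.lift K fun k : ℕ+ => e K (k : ℕ)

/-- `m^I = 2^{m_1(I)}`, where `m_1(I)` is the number of parts `1` of `I`. -/
def mC (K : Type*) [Field K] {n : ℕ} (I : Composition n) : K :=
  2 ^ I.blocks.count 1

/-- Membership in `𝓒_n`: every part is `1` or `2`, and the last part is `1`. -/
def InC {n : ℕ} (I : Composition n) : Prop :=
  (∀ i ∈ I.blocks, i = 1 ∨ i = 2) ∧ I.blocks.getLast? = some 1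

open Classical in
/-- `∑ m^I R_I` over the compositions `I ∈ 𝓒_n` with prefix `p`. -/
def ribbonSum (K : Type*) [Field K] (n : ℕ) (p : List ℕ) : NSym K :=
  ∑ I : Composition n with InC I ∧ p <+: I.blocks, mC K I • ribbon K I

/-- `Ã_n = ∑_{I ⊨ n} (i_1 - 1) ⋯ (i_l - 1) Λ^I`. -/
def Atilde (K : Type*) [Field K] (n : ℕ) : NSym K :=
  ∑ I : Composition n, (I.blocks.map fun i : ℕ => (i : K) - 1).prod • LamC K I

/-- `B̃_n = (1/2) ∑_{I = 12⋯ ∈ 𝓒_n} m^I R_I + (3/8) ∑_{I = 11⋯ ∈ 𝓒_n} m^I R_I`. -/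
def Btilde (K : Type*) [Field K] (n : ℕ) : NSym K :=
  (1 / 2 : K) • ribbonSum K n [1, 2] + (3 / 8 : K) • ribbonSum K n [1, 1]

end PathAnalog

end

noncomputable section

namespace PathAnalog

/-! ### Compositions as lists -/

/-! Let E = ∑ e_k t^k. Deleting the first vertex of a coloured path gives ∑ X_{P_n} t^n = E/(E -
tE') (`pathX_series_mul`). Put A = 1/(E - tE') and B = (E - e_1 t)A, so that EA = e_1 t A + B. Since
E - tE' = 1 - ∑ (k-1) e_k t^k does not involve e_1, neither do A and B; hence their coefficients are
the A_n and B_n. Expanding A over compositions gives Ã_n (`rho_Atilde`). Uniqueness is the algebraic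
independence of the e_k: in finitely many variables, setting e_1 = 0 kills e_1 f and fixes every g
free of e_1 (`eq_zero_of_e_one_mul_eq`).

For B̃_n, ρ(ε^I R_I) is the sum of ∏ c_j over the coarsenings of I, where c_k = (-1)^(k-1) h_k =
-[t^k] 1/E. Let q_a be the generating function of these sums over the lists a :: l, weighted by ε^l
m^l, with l nonempty, all parts of l equal to 1 or 2, and last part 1 (`weightedSeries`). Splitting
off the first part of l gives q_a - 2q_{a+1} + q_{a+2} = t^a (c_a G + 2t c_{a+1}), with G = 2q_1 -
q_2 + 2t c_1. Summed over a with weights a+1, the left side telescopes to q_0 = 0, whence (E - tE')G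
= 2tE'; with weights a it telescopes to q_1, whence q_1 = 2A - 2. Now q_2 and q_3 follow, and the
combination of the prefixes 12 and 11 equals 2(B - 1) - 4 e_2 t^2 (`weightedSeries_combination`,
`weightedSeries_signedH`). The exception n = 2 comes from the bare composition 11, whose remainder
is empty: the formula would give (3/2) e_2, while B_2 = 2 e_2. -/

/-- The lists of blocks of the compositions of `n`. -/
def compLists (n : ℕ) : Finset (List ℕ) :=
  (Finset.univ : Finset (Composition n)).image Composition.blocks

theorem mem_compLists {n : ℕ} {l : List ℕ} :
    l ∈ compLists n ↔ (∀ i ∈ l, 0 < i) ∧ l.sum = n := by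
  simp only [compLists, Finset.mem_image, Finset.mem_univ, true_and]
  constructor
  · rintro ⟨I, rfl⟩
    exact ⟨fun i hi => I.blocks_pos hi, I.blocks_sum⟩
  · rintro ⟨h, h'⟩
    exact ⟨⟨l, fun {i} hi => h i hi, h'⟩, rfl⟩

theorem sum_composition {M : Type*} [AddCommMonoid M] (n : ℕ) (f : List ℕ → M) :
    ∑ I : Composition n, f I.blocks = ∑ l ∈ compLists n, f l := by
  rw [compLists, Finset.sum_image]
  intro I _ J _ h
  exact Composition.ext h

theorem compLists_zero : compLists 0 = {[]} := by
  ext l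
  rw [mem_compLists, Finset.mem_singleton]
  constructor
  · rintro ⟨h, h'⟩
    cases l with
    | nil => rfl
    | cons a l =>
      have := h a (by simp)
      simp at h'
      omega
  · rintro rfl
    simp

theorem sum_compLists_succ {M : Type*} [AddCommMonoid M] (n : ℕ) (f : List ℕ → M) :
    ∑ l ∈ compLists (n + 1), f l =
      ∑ i ∈ Finset.range (n + 1), ∑ l ∈ compLists (n - i), f ((i + 1) :: l) := by
  rw [Finset.sum_sigma']
  symm
  refine Finset.sum_bij (fun p _ => (p.1 + 1) :: p.2) ?_ ?_ ?_ ?_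
  · rintro ⟨i, l⟩ h
    simp only [Finset.mem_sigma, Finset.mem_range, mem_compLists] at h
    simp only [mem_compLists, List.mem_cons, forall_eq_or_imp, List.sum_cons]
    exact ⟨⟨by omega, h.2.1⟩, by omega⟩
  · rintro ⟨i, l⟩ _ ⟨j, m⟩ _ h
    simp only [List.cons.injEq, Nat.add_right_cancel_iff] at h
    rw [h.1, h.2]
  · intro l hl
    rw [mem_compLists] at hl
    cases l with
    | nil => simp at hl
    | cons a l =>
      simp only [List.mem_cons, forall_eq_or_imp, List.sum_cons] at hl
      refine ⟨⟨a - 1, l⟩, ?_, ?_⟩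
      · simp only [Finset.mem_sigma, Finset.mem_range, mem_compLists]
        exact ⟨by omega, hl.1.2, by omega⟩
      · simp only [List.cons.injEq, and_true]
        omega
  · intros
    rfl

/-! ### Coarsenings -/

/-- The partial sums of a list, including `0`. -/
def partialSums : List ℕ → Finset ℕ
  | [] => {0}
  | a :: l => insert 0 ((partialSums l).map (addLeftEmbedding a))

theorem zero_mem_partialSums (l : List ℕ) : 0 ∈ partialSums l := by
  cases l <;> simp [partialSums]

theorem mem_partialSums_cons {a k : ℕ} {l : List ℕ} :
    k ∈ partialSums (a :: l) ↔ k = 0 ∨ ∃ s ∈ partialSums l, a + s = k := by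
  simp [partialSums]

theorem mem_partialSums {l : List ℕ} {k : ℕ} :
    k ∈ partialSums l ↔ ∃ i ≤ l.length, (l.take i).sum = k := by
  induction l generalizing k with
  | nil => simp [partialSums, eq_comm]
  | cons a l ih =>
    rw [mem_partialSums_cons]
    constructor
    · rintro (rfl | ⟨s, hs, rfl⟩)
      · exact ⟨0, by simp, by simp⟩
      · obtain ⟨i, hi, rfl⟩ := ih.1 hs
        exact ⟨i + 1, by simpa using hi, by simp⟩
    · rintro ⟨i, hi, rfl⟩
      cases i with
      | zero => left; simp
      | succ i =>
        right
        exact ⟨_, ih.2 ⟨i, by simpa using hi, rfl⟩, by simp⟩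

theorem boundaries_map_val {n : ℕ} (I : Composition n) :
    I.boundaries.map Fin.valEmbedding = partialSums I.blocks := by
  ext k
  rw [mem_partialSums]
  simp only [Composition.boundaries, Finset.mem_map, Finset.mem_univ, true_and]
  constructor
  · rintro ⟨_, ⟨i, rfl⟩, rfl⟩
    exact ⟨i, by have := i.2; rw [I.blocks_length]; omega, rfl⟩
  · rintro ⟨i, hi, rfl⟩
    rw [I.blocks_length] at hi
    exact ⟨_, ⟨⟨i, by omega⟩, rfl⟩, rfl⟩

/-- Boundaries live in `Fin (n + 1)`. As natural numbers they permit recursion on the list, during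
which the total changes. -/
theorem boundaries_subset_iff {n : ℕ} (I J : Composition n) :
    J.boundaries ⊆ I.boundaries ↔ partialSums J.blocks ⊆ partialSums I.blocks := by
  rw [← boundaries_map_val, ← boundaries_map_val, Finset.map_subset_map]

theorem partialSums_cons_subset_cons {a : ℕ} (ha : 0 < a) {l m : List ℕ} :
    partialSums (a :: l) ⊆ partialSums (a :: m) ↔ partialSums l ⊆ partialSums m := by
  constructor
  · intro h k hk
    have := h (mem_partialSums_cons.2 (Or.inr ⟨k, hk, rfl⟩))
    rcases mem_partialSums_cons.1 this with h0 | ⟨s, hs, hs'⟩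
    · omega
    · obtain rfl : s = k := by omega
      exact hs
  · intro h k hk
    rcases mem_partialSums_cons.1 hk with rfl | ⟨s, hs, rfl⟩
    · exact zero_mem_partialSums _
    · exact mem_partialSums_cons.2 (Or.inr ⟨s, h hs, rfl⟩)

theorem mem_partialSums_cons_cons {a b k : ℕ} {l : List ℕ} :
    k ∈ partialSums (a :: b :: l) ↔ k = a ∨ k ∈ partialSums ((a + b) :: l) := by
  simp only [mem_partialSums_cons]
  constructor
  · rintro (h | ⟨s, rfl | ⟨t, ht, rfl⟩, rfl⟩)
    · exact Or.inr (Or.inl h)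
    · exact Or.inl rfl
    · exact Or.inr (Or.inr ⟨t, ht, by omega⟩)
  · rintro (rfl | h | ⟨t, ht, rfl⟩)
    · exact Or.inr ⟨0, Or.inl rfl, by omega⟩
    · exact Or.inl h
    · exact Or.inr ⟨b + t, Or.inr ⟨t, ht, rfl⟩, by omega⟩

theorem eq_zero_or_le_of_mem_partialSums {a k : ℕ} {l : List ℕ} (h : k ∈ partialSums (a :: l)) :
    k = 0 ∨ a ≤ k := by
  rcases mem_partialSums_cons.1 h with h | ⟨s, _, rfl⟩ <;> omega

theorem head_mem_partialSums (a : ℕ) (l : List ℕ) : a ∈ partialSums (a :: l) :=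
  mem_partialSums_cons.2 (Or.inr ⟨0, zero_mem_partialSums l, rfl⟩)

/-! ### Coarsening sums and their weighted recurrence -/

section Ribbon

variable {A : Type*} [CommRing A] (c : ℕ → A)

/-- The sum of `∏ c_j` over all coarsenings of the list `a :: l`, computed recursively. -/
def coarseSum : ℕ → List ℕ → A
  | a, [] => c a
  | a, b :: l => c a * coarseSum b l + coarseSum (a + b) l

/-- A coarsening of `a :: b :: l` either keeps the boundary `a`, and then begins with the part `a`,
or drops it, and then coarsens `(a + b) :: l`. -/
theorem sum_coarsenings (a : ℕ) (l : List ℕ) (ha : 0 < a) (hl : ∀ i ∈ l, 0 < i) :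
    ∑ J ∈ compLists (a + l.sum) with partialSums J ⊆ partialSums (a :: l), (J.map c).prod =
      coarseSum c a l := by
  induction l generalizing a with
  | nil =>
    rw [coarseSum, Finset.sum_eq_single_of_mem [a]]
    · simp
    · simp [mem_compLists, ha]
    · intro J hJ hne
      exfalso
      simp only [Finset.mem_filter, mem_compLists, List.sum_nil, add_zero] at hJ
      obtain ⟨⟨hpos, hsum⟩, hsub⟩ := hJ
      cases J with
      | nil => simp at hsum; omega
      | cons j J =>
        have h1 := hsub (head_mem_partialSums j J)
        have hj : 0 < j := hpos j (by simp)
        simp only [List.sum_cons] at hsum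
        rcases eq_zero_or_le_of_mem_partialSums h1 with h | h
        · omega
        · have hJ : J ∈ compLists 0 :=
            mem_compLists.2 ⟨fun i hi => hpos i (by simp [hi]), by omega⟩
          rw [compLists_zero, Finset.mem_singleton] at hJ
          subst hJ
          simp at hsum
          exact hne (by rw [hsum])
  | cons b l ih =>
    have hb : 0 < b := hl b (by simp)
    have hl' : ∀ i ∈ l, 0 < i := fun i hi => hl i (by simp [hi])
    rw [coarseSum, ← Finset.sum_filter_add_sum_filter_not _ (fun J => a ∈ partialSums J)]
    congr 1
    · rw [← ih b hb hl', Finset.mul_sum]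
      symm
      refine Finset.sum_bij (fun J _ => a :: J) ?_ ?_ ?_ ?_
      · intro J hJ
        simp only [Finset.mem_filter, mem_compLists] at hJ ⊢
        obtain ⟨⟨hpos, hsum⟩, hsub⟩ := hJ
        refine ⟨⟨⟨?_, ?_⟩, (partialSums_cons_subset_cons ha).2 hsub⟩, head_mem_partialSums a J⟩
        · simp only [List.mem_cons, forall_eq_or_imp]
          exact ⟨ha, hpos⟩
        · simp [hsum]
      · intro J _ J' _ h
        exact (List.cons.inj h).2
      · intro J hJ
        simp only [Finset.mem_filter, mem_compLists] at hJ
        obtain ⟨⟨⟨hpos, hsum⟩, hsub⟩, haJ⟩ := hJ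
        cases J with
        | nil => simp at hsum; omega
        | cons j J =>
          have hj : 0 < j := hpos j (by simp)
          have h1 := eq_zero_or_le_of_mem_partialSums (hsub (head_mem_partialSums j J))
          have h2 := eq_zero_or_le_of_mem_partialSums haJ
          -- `j` is a partial sum of `a :: b :: l`, so `a ≤ j`; `a` is one of `j :: J`, so `j ≤ a`.
          obtain rfl : j = a := by omega
          refine ⟨J, ?_, rfl⟩
          simp only [Finset.mem_filter, mem_compLists]
          refine ⟨⟨fun i hi => hpos i (by simp [hi]), ?_⟩, (partialSums_cons_subset_cons ha).1 hsub⟩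
          simp only [List.sum_cons] at hsum
          omega
      · intro J _
        simp
    · rw [← ih (a + b) (by omega) hl', Finset.filter_filter]
      refine Finset.sum_congr ?_ fun _ _ => rfl
      ext J
      simp only [Finset.mem_filter, List.sum_cons, add_assoc]
      refine and_congr_right fun _ => ?_
      constructor
      · rintro ⟨h, h'⟩ k hk
        rcases mem_partialSums_cons_cons.1 (h hk) with rfl | h
        · exact absurd hk h'
        · exact h
      · intro h
        refine ⟨fun k hk => mem_partialSums_cons_cons.2 (Or.inr (h hk)), fun h' => ?_⟩
        rcases eq_zero_or_le_of_mem_partialSums (h h') with h | h <;> omega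

/-- Cutting after the part `0` and merging it into `b` cancel. This supplies the boundary value q_0
= 0 of the telescoping sums. -/
theorem coarseSum_zero_cons (h0 : c 0 = -1) (b : ℕ) (l : List ℕ) : coarseSum c 0 (b :: l) = 0 := by
  rw [coarseSum, h0, zero_add]
  ring

/-- The signed weight `ε^I m^I` of a list with parts `1` and `2` whose last part is `1`, and `0` for
all other lists. -/
def weight (A : Type*) [CommRing A] : List ℕ → A
  | [] => 0
  | i :: l => if i = 1 then 2 * (if l = [] then 1 else weight A l) else
      if i = 2 then -weight A l else 0

-- In the recursion a part `1` leaves ε unchanged and a part `2` reverses it; the value `0` at `[]`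
-- eliminates the lists that end in `2`.
open Classical in
theorem weight_eq (l : List ℕ) (hl : ∀ i ∈ l, 0 < i) :
    weight A l = if (∀ i ∈ l, i = 1 ∨ i = 2) ∧ l.getLast? = some 1 then
      2 ^ l.count 1 * (-1) ^ (l.sum - l.length) else 0 := by
  induction l with
  | nil => simp [weight]
  | cons a l ih =>
    have hl' : ∀ i ∈ l, 0 < i := fun i hi => hl i (by simp [hi])
    have hle : l.length ≤ l.sum := by
      simpa using List.card_nsmul_le_sum l 1 hl'
    rw [weight, ih hl']
    by_cases h1 : a = 1
    · subst h1
      by_cases h : l = []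
      · subst h
        simp
      · have e1 : 1 + l.sum - (l.length + 1) = l.sum - l.length := by omega
        have e2 : (1 :: l).getLast? = l.getLast? := by
          cases l with
          | nil => exact absurd rfl h
          | cons b l => simp [List.getLast?_cons_cons]
        simp only [if_true, h, if_false, e2, List.mem_cons, forall_eq_or_imp, true_or, true_and,
          List.sum_cons, List.length_cons, e1, List.count_cons_self, mul_ite, mul_zero]
        congr 1
        ring
    · by_cases h2 : a = 2
      · subst h2
        have e1 : 2 + l.sum - (l.length + 1) = (l.sum - l.length) + 1 := by omega
        by_cases h : l = []
        · subst h
          simp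
        · have e2 : (2 :: l).getLast? = l.getLast? := by
            cases l with
            | nil => exact absurd rfl h
            | cons b l => simp [List.getLast?_cons_cons]
          have e3 : (2 :: l).count 1 = l.count 1 := by simp
          simp only [h1, if_true, if_false, e2, e3, List.mem_cons, forall_eq_or_imp, or_true,
            true_and, List.sum_cons, List.length_cons, e1]
          split_ifs
          · ring
          · ring
      · simp [h1, h2]

/-- The sum of `weight l * coarseSum c a l` over the compositions `l` of `n`. -/
def weightedSum (a n : ℕ) : A :=
  ∑ l ∈ compLists n, weight A l * coarseSum c a l

theorem weightedSum_zero (a : ℕ) : weightedSum c a 0 = 0 := by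
  simp [weightedSum, compLists_zero, weight]

theorem weightedSum_zero_left (h0 : c 0 = -1) (n : ℕ) : weightedSum c 0 n = 0 := by
  refine Finset.sum_eq_zero fun l _ => ?_
  cases l with
  | nil => simp [weight]
  | cons b l => rw [coarseSum_zero_cons c h0, mul_zero]

theorem weightedSum_one (a : ℕ) : weightedSum c a 1 = 2 * (c a * c 1 + c (a + 1)) := by
  rw [weightedSum, sum_compLists_succ]
  simp [compLists_zero, weight, coarseSum]

theorem sum_weight_cons (a b n : ℕ) :
    ∑ l ∈ compLists n, weight A l * coarseSum c a (b :: l) =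
      c a * weightedSum c b n + weightedSum c (a + b) n := by
  rw [weightedSum, weightedSum, Finset.mul_sum, ← Finset.sum_add_distrib]
  refine Finset.sum_congr rfl fun l _ => ?_
  rw [coarseSum]
  ring

theorem ne_nil_of_mem_compLists_succ {n : ℕ} {l : List ℕ} (h : l ∈ compLists (n + 1)) : l ≠ [] := by
  rintro rfl
  simp [mem_compLists] at h

/-- The first part is `1` (factor 2) or `2` (factor -1), and it is either cut off from `a` or merged
with it. With total at least 2, the remainder after a `1` is nonempty, so the special case of
`weight` does not occur. -/
theorem weightedSum_add_two (a n : ℕ) : weightedSum c a (n + 2) =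
    2 * (c a * weightedSum c 1 (n + 1) + weightedSum c (a + 1) (n + 1)) -
      (c a * weightedSum c 2 n + weightedSum c (a + 2) n) := by
  rw [weightedSum, sum_compLists_succ, Finset.sum_range_succ', Finset.sum_range_succ',
    Finset.sum_eq_zero, ← sum_weight_cons, ← sum_weight_cons, zero_add, Finset.mul_sum,
    sub_eq_neg_add, ← Finset.sum_neg_distrib]
  · congr 1
    · refine Finset.sum_congr (by congr 1) fun l _ => ?_
      simp [weight]
    · refine Finset.sum_congr (by congr 1) fun l hl => ?_
      simp [weight, ne_nil_of_mem_compLists_succ hl, mul_assoc]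
  · intro i _
    refine Finset.sum_eq_zero fun l _ => ?_
    simp [weight]

end Ribbon

open PowerSeries

/-! ### Solving the recurrence by generating functions -/

section Series

variable {A : Type*} [CommRing A]

/-- The diagonal sum of a family of power series, which is the sum of the family if `X ^ a` divides
its `a`-th member. -/
def diagSum (f : ℕ → A⟦X⟧) : A⟦X⟧ :=
  PowerSeries.mk fun n => ∑ a ∈ Finset.range (n + 1), coeff n (f a)

theorem diagSum_add (f g : ℕ → A⟦X⟧) : diagSum (fun a => f a + g a) = diagSum f + diagSum g := by
  ext n
  simp [diagSum, Finset.sum_add_distrib]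

theorem diagSum_X_pow_mul (u : ℕ → A) (G : A⟦X⟧) :
    diagSum (fun a => X ^ a * (C (u a) * G)) = PowerSeries.mk u * G := by
  ext n
  rw [diagSum, coeff_mk, coeff_mul, Finset.Nat.sum_antidiagonal_eq_sum_range_succ_mk]
  refine Finset.sum_congr rfl fun a ha => ?_
  rw [Finset.mem_range] at ha
  rw [coeff_X_pow_mul', if_pos (by omega), coeff_C_mul, coeff_mk]

/-- Summation by parts: the second difference of a linear weight is zero, so only boundary terms
remain. -/
theorem sum_succ_mul_second_difference (x : ℕ → A) (m : ℕ) :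
    ∑ a ∈ Finset.range m, ((a : A) + 1) * (x a - 2 * x (a + 1) + x (a + 2)) =
      x 0 - (m + 1) * x m + m * x (m + 1) := by
  induction m with
  | zero => simp
  | succ m ih =>
    rw [Finset.sum_range_succ, ih]
    push_cast
    ring

theorem sum_mul_second_difference (x : ℕ → A) (m : ℕ) :
    ∑ a ∈ Finset.range m, (a : A) * (x a - 2 * x (a + 1) + x (a + 2)) =
      x 1 - m * x m + (m - 1) * x (m + 1) := by
  induction m with
  | zero => simp
  | succ m ih =>
    rw [Finset.sum_range_succ, ih]
    push_cast
    ring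

variable (c : ℕ → A)

/-- The power series `X ^ a * ∑ weightedSum c a n * X ^ n`. -/
def weightedSeries (a : ℕ) : A⟦X⟧ :=
  X ^ a * PowerSeries.mk (weightedSum c a)

/-- The last summand is the contribution of the one-part list `[1]`, which the recurrence does not
cover. -/
theorem mk_weightedSum (a : ℕ) : PowerSeries.mk (weightedSum c a) =
    2 * X * (C (c a) * PowerSeries.mk (weightedSum c 1) + PowerSeries.mk (weightedSum c (a + 1))) -
      X ^ 2 * (C (c a) * PowerSeries.mk (weightedSum c 2) +
        PowerSeries.mk (weightedSum c (a + 2))) +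
      2 * X * (C (c a) * C (c 1) + C (c (a + 1))) := by
  have h2 : (2 : A⟦X⟧) = C 2 := (map_ofNat C 2).symm
  ext n
  rw [h2, mul_assoc, mul_assoc, ← C.map_mul, ← C.map_add]
  rcases n with _ | _ | n
  · simp [weightedSum_zero]
  · simp only [map_add, map_sub, coeff_C_mul, zero_add, coeff_mk, weightedSum_one,
      coeff_succ_X_mul, coeff_X_pow_mul', weightedSum_zero]
    simp
  · simp only [map_add, map_sub, coeff_C_mul, coeff_mk, weightedSum_add_two,
      coeff_succ_X_mul, coeff_X_pow_mul']
    simp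

theorem weightedSeries_recurrence (a : ℕ) :
    weightedSeries c a - 2 * weightedSeries c (a + 1) + weightedSeries c (a + 2) =
      X ^ a * (C (c a) * (2 * weightedSeries c 1 - weightedSeries c 2 + 2 * X * C (c 1))) +
        X ^ a * (C (c (a + 1)) * (2 * X)) := by
  simp only [weightedSeries]
  rw [mk_weightedSum c a]
  ring

theorem coeff_weightedSeries (a n : ℕ) (h : n < a + 1) : coeff n (weightedSeries c a) = 0 := by
  rw [weightedSeries, coeff_X_pow_mul']
  split_ifs with h'
  · rw [show n - a = 0 by omega, coeff_mk, weightedSum_zero]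
  · rfl

theorem weightedSeries_zero (h0 : c 0 = -1) : weightedSeries c 0 = 0 := by
  ext n
  simp [weightedSeries, weightedSum_zero_left c h0]

theorem sum_recurrence (w : ℕ → A) :
    diagSum (fun a => C (w a) *
      (weightedSeries c a - 2 * weightedSeries c (a + 1) + weightedSeries c (a + 2))) =
    PowerSeries.mk (fun a => w a * c a) *
        (2 * weightedSeries c 1 - weightedSeries c 2 + 2 * X * C (c 1)) +
      PowerSeries.mk (fun a => w a * c (a + 1)) * (2 * X) := by
  rw [← diagSum_X_pow_mul, ← diagSum_X_pow_mul, ← diagSum_add]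
  congr 1
  funext a
  rw [weightedSeries_recurrence, map_mul, map_mul]
  ring

theorem diagSum_succ_weightedSeries (h0 : c 0 = -1) :
    diagSum (fun a => C ((a : A) + 1) *
      (weightedSeries c a - 2 * weightedSeries c (a + 1) + weightedSeries c (a + 2))) = 0 := by
  ext n
  have h2 : (2 : A⟦X⟧) = C 2 := (map_ofNat C 2).symm
  -- The upper boundary terms involve indices above `n`, where the coefficient at `n` is zero.
  have := sum_succ_mul_second_difference (fun a => coeff n (weightedSeries c a)) (n + 1)
  rw [coeff_weightedSeries c (n + 1) n (by omega), coeff_weightedSeries c (n + 1 + 1) n (by omega),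
    weightedSeries_zero c h0] at this
  rw [diagSum, coeff_mk]
  simp only [coeff_C_mul, map_add (coeff n), map_sub (coeff n), h2]
  rw [this]
  simp

theorem diagSum_weightedSeries :
    diagSum (fun a => C (a : A) *
      (weightedSeries c a - 2 * weightedSeries c (a + 1) + weightedSeries c (a + 2))) =
        weightedSeries c 1 := by
  ext n
  have h2 : (2 : A⟦X⟧) = C 2 := (map_ofNat C 2).symm
  have := sum_mul_second_difference (fun a => coeff n (weightedSeries c a)) (n + 1)
  rw [coeff_weightedSeries c (n + 1) n (by omega),
    coeff_weightedSeries c (n + 1 + 1) n (by omega)] at this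
  rw [diagSum, coeff_mk]
  simp only [coeff_C_mul, map_add (coeff n), map_sub (coeff n), h2]
  rw [this]
  simp

/-- `E - X E'`. -/
def reduced (E : A⟦X⟧) : A⟦X⟧ := E - X * derivative A E

theorem coeff_of_mul_eq_one {E D : A⟦X⟧} (hE : constantCoeff E = 1) (hED : E * D = 1) :
    constantCoeff D = 1 ∧ coeff 1 D = -coeff 1 E ∧
      coeff 2 D = coeff 1 E * coeff 1 E - coeff 2 E := by
  have hE0 : coeff 0 E = 1 := by simpa using hE
  have c0 := congrArg (coeff 0) hED
  have c1 := congrArg (coeff 1) hED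
  have c2 := congrArg (coeff 2) hED
  simp only [coeff_mul, Finset.Nat.antidiagonal_succ, Finset.Nat.antidiagonal_zero] at c0 c1 c2
  simp [hE, coeff_one] at c0 c1 c2
  rw [c0] at c1 c2
  exact ⟨c0, by linear_combination c1, by linear_combination c2 - coeff 1 E * c1⟩

/-- If `c_a = -[X^a] 1/E`, the ribbon series with prefixes `12` and `11` combine to
`(X E' - e_1 X) / (E - X E') - 2 e_2 X^2`. -/
theorem weightedSeries_combination {E D N : A⟦X⟧} (hE : constantCoeff E = 1) (hED : E * D = 1)
    (hFN : reduced E * N = 1) (hc : ∀ a, c a = -coeff a D) :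
    3 * (X * C (c 1) * weightedSeries c 1 + weightedSeries c 2) -
      2 * (X * C (c 1) * weightedSeries c 2 + weightedSeries c 3) =
    2 * ((X * derivative A E - C (coeff 1 E) * X) * N) - 4 * C (coeff 2 E) * X ^ 2 := by
  obtain ⟨c0, c1, c2⟩ := coeff_of_mul_eq_one hE hED
  have hc0 : c 0 = -1 := by rw [hc, coeff_zero_eq_constantCoeff, c0]
  have hc1 : c 1 = coeff 1 E := by rw [hc, c1, neg_neg]
  have hc2 : c 1 * c 1 + c 2 = coeff 2 E := by
    rw [hc1, hc, c2]
    ring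
  have hD : derivative A D = -derivative A E * D ^ 2 := by
    have := congrArg (derivative A) hED
    rw [Derivation.leibniz, derivative_one, smul_eq_mul, smul_eq_mul] at this
    linear_combination D * this - derivative A D * hED
  -- Since ∑ c_a X^a = -D, each of the weighted series `m1`–`m4` is expressed by D and its
  -- derivative.
  have m1 : PowerSeries.mk (fun a => ((a : A) + 1) * c a) = -D - X * derivative A D := by
    ext n
    cases n with
    | zero => simp [hc]
    | succ n =>
      simp only [coeff_mk, map_sub, map_neg, coeff_succ_X_mul, coeff_derivative, hc]
      push_cast
      ring
  have m2 : PowerSeries.mk (fun a => ((a : A) + 1) * c (a + 1)) = -derivative A D := by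
    ext n
    simp only [coeff_mk, map_neg, coeff_derivative, hc]
    ring
  have m3 : PowerSeries.mk (fun a => (a : A) * c a) = - X * derivative A D := by
    ext n
    cases n with
    | zero => simp
    | succ n =>
      simp only [coeff_mk, neg_mul, map_neg, coeff_succ_X_mul, coeff_derivative, hc]
      push_cast
      ring
  have m4 : X * PowerSeries.mk (fun a => (a : A) * c (a + 1)) = - X * derivative A D + (D - 1) := by
    ext n
    cases n with
    | zero => simp [c0]
    | succ n =>
      simp only [coeff_mk, neg_mul, map_neg, map_add, map_sub, coeff_succ_X_mul, coeff_derivative,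
        hc, coeff_one]
      simp
      ring
  have s1 := sum_recurrence c (fun a => (a : A) + 1)
  have s2 := sum_recurrence c (fun a => (a : A))
  rw [diagSum_succ_weightedSeries c hc0, m1, m2, hD] at s1
  rw [diagSum_weightedSeries, m3] at s2
  have r1 := weightedSeries_recurrence c 1
  have hc2' : (C (c 1) * C (c 1) + C (c 2) : A⟦X⟧) = C (coeff 2 E) := by
    rw [← hc2, map_add, map_mul]
  have hc1' : (C (c 1) : A⟦X⟧) = C (coeff 1 E) := by rw [hc1]
  simp only [Nat.reduceAdd, pow_one] at r1
  rw [reduced] at hFN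
  rw [← hc1', ← hc2']
  set q1 := weightedSeries c 1
  set q2 := weightedSeries c 2
  set q3 := weightedSeries c 3
  set G := 2 * q1 - q2 + 2 * X * C (c 1) with hG
  set E' := derivative A E
  rw [hD] at m4 s2
  -- After multiplication by E², `s1` is a linear equation for G with leading coefficient E - XE',
  -- whose inverse is N.
  have hGF : G = 2 * X * E' * N := by
    have h1 : (E - X * E') * G = 2 * X * E' := by
      linear_combination E ^ 2 * s1 + (-E * G + X * E' * (G + 2) * (E * D + 1)) * hED
    linear_combination N * h1 - G * hFN
  have hq1 : q1 = 2 * N - 2 := by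
    linear_combination s2 + 2 * m4 + X * E' * D ^ 2 * hGF -
      2 * (D + X * E' * D ^ 2) * hFN + 2 * N * (1 + X * E' * D) * hED
  -- With `q1` and `G` known, the definition of `G` yields `q2`, and the recurrence at `a = 1`
  -- yields `q3`.
  have hq2 : q2 = 2 * q1 + 2 * X * C (c 1) - G := by rw [hG]; ring
  have hq3 : q3 = 2 * q2 - q1 + X * (C (c 1) * G) + X * (C (c 2) * (2 * X)) := by
    linear_combination r1
  rw [hq3, hq2, hq1, hGF]
  ring

end Series

/-! ### Restriction to finitely many variables -/

section Truncation

variable {R : Type*} [CommRing R]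

/-- Setting all variables but the first `N` equal to `0`. -/
def truncation (R : Type*) [CommRing R] (N : ℕ) : Sym R →ₐ[R] MvPowerSeries (Fin N) R :=
  (MvPowerSeries.killCompl (Fin.valEmbedding (n := N))).comp (Sym R).val

theorem coeff_truncation (N : ℕ) (f : Sym R) (d : Fin N →₀ ℕ) :
    MvPowerSeries.coeff d (truncation R N f) =
      MvPowerSeries.coeff (d.embDomain Fin.valEmbedding) f.1 :=
  MvPowerSeries.coeff_killCompl _ _

theorem eq_zero_of_truncation {f : Sym R} (M : ℕ) (h : ∀ N, M ≤ N → truncation R N f = 0) :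
    f = 0 := by
  refine Subtype.ext (MvPowerSeries.ext fun d => ?_)
  obtain ⟨b, hb⟩ := d.support.bddAbove
  have hd : d ∈ Set.range (Finsupp.embDomain (M := ℕ)
      (Fin.valEmbedding (n := max M (b + 1)))) := by
    rw [Finsupp.mem_range_embDomain_iff]
    intro i hi
    have : i ≤ b := hb hi
    exact ⟨⟨i, by omega⟩, rfl⟩
  obtain ⟨d', rfl⟩ := hd
  rw [← coeff_truncation, h _ (le_max_left _ _)]
  simp

theorem sum_single_embDomain {V : Type*} [Fintype V] {N : ℕ} (κ : V → Fin N) :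
    (∑ v, Finsupp.single (κ v) 1 : Fin N →₀ ℕ).embDomain Fin.valEmbedding =
      content fun v => (κ v : ℕ) := by
  rw [content, Finsupp.embDomain_eq_mapDomain, Finsupp.mapDomain_finsetSum]
  simp [Finsupp.mapDomain_single]

open Classical in
theorem truncation_e (N k : ℕ) :
    truncation R N (e R k) = (MvPolynomial.esymm (Fin N) R k : MvPowerSeries (Fin N) R) := by
  ext d
  rw [coeff_truncation, MvPolynomial.coeff_coe, MvPolynomial.esymm_eq_sum_monomial,
    MvPolynomial.coeff_sum]
  simp only [MvPolynomial.coeff_monomial]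
  change (if (d.embDomain Fin.valEmbedding).degree = k ∧
    ∀ i, d.embDomain Fin.valEmbedding i ≤ 1 then (1 : R) else 0) = _
  have h1 : (d.embDomain Fin.valEmbedding).degree = d.degree := by
    rw [Finsupp.embDomain_eq_mapDomain, Finsupp.degree_mapDomain]
  have h2 : (∀ i, d.embDomain Fin.valEmbedding i ≤ 1) ↔ ∀ i, d i ≤ 1 := by
    constructor
    · intro h i
      have := h (Fin.valEmbedding i)
      rwa [Finsupp.embDomain_apply_self] at this
    · intro h i
      by_cases hi : i ∈ Set.range (Fin.valEmbedding (n := N))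
      · obtain ⟨j, rfl⟩ := hi
        rw [Finsupp.embDomain_apply_self]
        exact h j
      · rw [Finsupp.embDomain_of_notMem_range _ _ _ hi]
        exact zero_le_one
  have key : ∀ t : Finset (Fin N), ∀ i, (∑ j ∈ t, Finsupp.single j 1 : Fin N →₀ ℕ) i =
      if i ∈ t then 1 else 0 := by
    intro t i
    simp [Finsupp.finsetSum_apply, Finsupp.single_apply]
  rw [h1, h2]
  split_ifs with h
  · have hd : (∑ j ∈ d.support, Finsupp.single j 1 : Fin N →₀ ℕ) = d := by
      ext i
      rw [key]
      have := h.2 i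
      split_ifs with h'
      · rw [Finsupp.mem_support_iff] at h'
        omega
      · rw [Finsupp.notMem_support_iff] at h'
        omega
    rw [Finset.sum_eq_single_of_mem d.support]
    · rw [if_pos hd]
    · rw [Finset.mem_powersetCard]
      refine ⟨Finset.subset_univ _, ?_⟩
      rw [← h.1]
      conv_rhs => rw [← hd]
      simp
    · intro t _ hne
      rw [if_neg]
      rintro rfl
      apply hne
      ext i
      rw [Finsupp.mem_support_iff, key]
      simp
  · symm
    refine Finset.sum_eq_zero fun t ht => if_neg ?_
    rintro rfl
    refine h ⟨?_, fun i => ?_⟩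
    · rw [Finset.mem_powersetCard] at ht
      simp [map_sum, ht.2]
    · rw [key]
      split_ifs <;> simp

open Classical in
/-- The chromatic polynomial in `N` variables. -/
def chromaticPoly (R : Type*) [CommRing R] {V : Type*} [Fintype V] [DecidableEq V]
    (G : SimpleGraph V) (N : ℕ) :
    MvPolynomial (Fin N) R :=
  ∑ κ : V → Fin N with ∀ u v, G.Adj u v → κ u ≠ κ v, ∏ v, MvPolynomial.X (κ v)

theorem truncation_chromaticSym {V : Type*} [Fintype V] [DecidableEq V]
    (G : SimpleGraph V) (N : ℕ) :
    truncation R N (chromaticSym R G) = (chromaticPoly R G N : MvPowerSeries (Fin N) R) := by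
  classical
  ext d
  rw [coeff_truncation, MvPolynomial.coeff_coe, chromaticPoly, MvPolynomial.coeff_sum]
  change (Nat.card {κ : G.Coloring ℕ // content κ = d.embDomain Fin.valEmbedding} : R) = _
  have hX : ∀ κ : V → Fin N, (∏ v, MvPolynomial.X (κ v) : MvPolynomial (Fin N) R) =
      MvPolynomial.monomial (∑ v, Finsupp.single (κ v) 1) 1 := fun κ => by
    rw [MvPolynomial.monomial_sum_one]
    rfl
  simp only [hX, MvPolynomial.coeff_monomial]
  rw [← Finset.sum_filter, Finset.filter_filter, Finset.sum_const, nsmul_eq_mul, mul_one,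
    ← Fintype.card_subtype, ← Nat.card_eq_fintype_card]
  congr 1
  symm
  refine Nat.card_eq_of_bijective (fun κ => ⟨SimpleGraph.Coloring.mk (fun v => (κ.1 v : ℕ))
    (fun {u v} h h' => κ.2.1 u v h (Fin.ext h')), ?_⟩) ⟨?_, ?_⟩
  · exact (sum_single_embDomain κ.1).symm.trans
      (congrArg (Finsupp.embDomain Fin.valEmbedding) κ.2.2)
  · rintro ⟨κ, h⟩ ⟨κ', h'⟩ hh
    refine Subtype.ext (funext fun v => Fin.ext ?_)
    exact DFunLike.congr_fun (congrArg Subtype.val hh) v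
  · rintro ⟨κ, h⟩
    -- The content has no exponent outside the first `N` variables, so no colour `≥ N` is used.
    have hlt : ∀ v, κ v < N := by
      intro v
      by_contra hv
      have h0 : d.embDomain Fin.valEmbedding (κ v) = 0 := by
        refine Finsupp.embDomain_of_notMem_range _ _ _ ?_
        rintro ⟨i, hi⟩
        exact hv (hi ▸ i.2)
      rw [← h, content, Finsupp.finsetSum_apply, Finset.sum_eq_zero_iff] at h0
      simpa using h0 v (Finset.mem_univ v)
    refine ⟨⟨fun v => ⟨κ v, hlt v⟩, fun u v huv h' => κ.valid huv (Fin.mk.inj h'), ?_⟩, ?_⟩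
    · refine Finsupp.embDomain_injective Fin.valEmbedding ?_
      rw [sum_single_embDomain, ← h]
    · refine Subtype.ext ?_
      ext v
      rfl

end Truncation

/-! ### The generating function of path colourings -/

section Path

variable (R : Type*) [CommRing R] (N : ℕ)

open Classical in
/-- The part of the chromatic polynomial of the path that belongs to the colourings whose first
vertex has colour `i`. -/
def pathPolyFrom (i : Fin N) (n : ℕ) : MvPolynomial (Fin N) R :=
  ∑ κ : Fin n → Fin N with (∀ u v, (SimpleGraph.pathGraph n).Adj u v → κ u ≠ κ v) ∧
    ∃ h : 0 < n, κ ⟨0, h⟩ = i, ∏ v, MvPolynomial.X (κ v)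

theorem proper_cons_iff {α : Type*} {n : ℕ} (i : α) (κ : Fin n → α) :
    (∀ u v, (SimpleGraph.pathGraph (n + 1)).Adj u v →
      (Fin.cons i κ : Fin (n + 1) → α) u ≠ (Fin.cons i κ : Fin (n + 1) → α) v) ↔
    (∀ u v, (SimpleGraph.pathGraph n).Adj u v → κ u ≠ κ v) ∧ ¬∃ h : 0 < n, κ ⟨0, h⟩ = i := by
  simp only [SimpleGraph.pathGraph_adj]
  constructor
  · intro h
    refine ⟨fun u v huv => ?_, ?_⟩
    · simpa using h u.succ v.succ (by simp only [Fin.val_succ]; omega)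
    · rintro ⟨hn, rfl⟩
      exact h 0 (Fin.succ ⟨0, hn⟩) (by simp) (by rw [Fin.cons_zero, Fin.cons_succ])
  · rintro ⟨h, h'⟩ u v
    refine Fin.cases ?_ (fun u => ?_) u <;> refine Fin.cases ?_ (fun v => ?_) v
    · simp
    · intro huv
      simp only [Fin.val_zero, Fin.val_succ] at huv
      rw [Fin.cons_zero, Fin.cons_succ]
      rintro rfl
      exact h' ⟨v.pos, congrArg κ (Fin.ext (by simp; omega))⟩
    · intro huv
      simp only [Fin.val_zero, Fin.val_succ] at huv
      rw [Fin.cons_zero, Fin.cons_succ]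
      rintro rfl
      exact h' ⟨u.pos, congrArg κ (Fin.ext (by simp; omega))⟩
    · intro huv
      simp only [Fin.val_succ] at huv
      rw [Fin.cons_succ, Fin.cons_succ]
      exact h u v (by omega)

theorem pathPolyFrom_zero (i : Fin N) : pathPolyFrom R N i 0 = 0 := by
  simp [pathPolyFrom]

/-- Removing the first vertex leaves any proper colouring that does not start with `i`. The
convention `pathPolyFrom R N i 0 = 0` makes this valid for `n = 0`. -/
theorem pathPolyFrom_succ (i : Fin N) (n : ℕ) : pathPolyFrom R N i (n + 1) =
    MvPolynomial.X i *
      (chromaticPoly R (SimpleGraph.pathGraph n) N - pathPolyFrom R N i n) := by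
  classical
  have hsplit : chromaticPoly R (SimpleGraph.pathGraph n) N = pathPolyFrom R N i n +
      ∑ κ : Fin n → Fin N with (∀ u v, (SimpleGraph.pathGraph n).Adj u v → κ u ≠ κ v) ∧
        ¬∃ h : 0 < n, κ ⟨0, h⟩ = i, ∏ v, MvPolynomial.X (κ v) := by
    rw [chromaticPoly, ← Finset.sum_filter_add_sum_filter_not _
      (fun κ : Fin n → Fin N => ∃ h : 0 < n, κ ⟨0, h⟩ = i), Finset.filter_filter,
      Finset.filter_filter, pathPolyFrom]
    congr!
  rw [hsplit, add_sub_cancel_left, Finset.mul_sum, pathPolyFrom]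
  symm
  refine Finset.sum_bij (fun κ _ => Fin.cons i κ) ?_ ?_ ?_ ?_
  · intro κ hκ
    rw [Finset.mem_filter] at hκ ⊢
    exact ⟨Finset.mem_univ _, (proper_cons_iff i κ).2 hκ.2, Nat.succ_pos n, rfl⟩
  · intro κ _ κ' _ h
    exact (Fin.cons_right_injective (α := fun _ => Fin N) i) h
  · intro κ hκ
    rw [Finset.mem_filter] at hκ
    obtain ⟨_, h, _, h0⟩ := hκ
    have hc : Fin.cons i (Fin.tail κ) = κ := by
      rw [← h0]
      exact Fin.cons_self_tail κ
    refine ⟨Fin.tail κ, ?_, hc⟩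
    rw [Finset.mem_filter]
    refine ⟨Finset.mem_univ _, (proper_cons_iff i _).1 ?_⟩
    rw [hc]
    exact h
  · intro κ _
    rw [Fin.prod_univ_succ]
    simp

theorem chromaticPoly_path_zero : chromaticPoly R (SimpleGraph.pathGraph 0) N = 1 := by
  simp [chromaticPoly]

theorem chromaticPoly_path_succ (n : ℕ) : chromaticPoly R (SimpleGraph.pathGraph (n + 1)) N =
    ∑ i, pathPolyFrom R N i (n + 1) := by
  classical
  rw [chromaticPoly, ← Finset.sum_fiberwise _ (fun κ : Fin (n + 1) → Fin N => κ 0)]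
  refine Finset.sum_congr rfl fun i _ => ?_
  rw [pathPolyFrom, Finset.filter_filter]
  refine Finset.sum_congr ?_ fun _ _ => rfl
  ext κ
  simp only [Finset.mem_filter, Nat.succ_pos, exists_true_left]
  rfl

theorem coeff_prod_one_add_C_mul_X (k : ℕ) :
    coeff k (∏ i : Fin N, (1 + C (MvPolynomial.X i : MvPolynomial (Fin N) R) * X)) =
      MvPolynomial.esymm (Fin N) R k := by
  classical
  rw [Finset.prod_one_add, map_sum, MvPolynomial.esymm, Finset.powersetCard_eq_filter,
    Finset.sum_filter]
  refine Finset.sum_congr rfl fun t _ => ?_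
  rw [Finset.prod_mul_distrib, Finset.prod_const, ← map_prod, coeff_C_mul, coeff_X_pow]
  simp only [eq_comm, mul_ite, mul_one, mul_zero]

theorem derivative_prod {A ι : Type*} [CommRing A] [DecidableEq ι] (s : Finset ι)
    (f : ι → A⟦X⟧) : derivative A (∏ i ∈ s, f i) =
      ∑ i ∈ s, (∏ j ∈ s.erase i, f j) * derivative A (f i) := by
  induction s using Finset.induction_on with
  | empty => simp
  | insert a s ha ih =>
    rw [Finset.prod_insert ha, Derivation.leibniz, ih, Finset.sum_insert ha,
      Finset.erase_insert ha, smul_eq_mul, smul_eq_mul, add_comm, Finset.mul_sum]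
    congr 1
    refine Finset.sum_congr rfl fun i hi => ?_
    have hne : a ≠ i := by
      rintro rfl
      exact ha hi
    rw [Finset.erase_insert_of_ne hne, Finset.prod_insert (by simp [ha]), mul_assoc]

/-- If F_i counts the colourings starting with `i`, then (1 + x_i t) F_i = x_i t x and x = 1 + ∑
F_i. As E = ∏ (1 + x_i t), summing over `i` produces the logarithmic derivative: (x - 1) E = t E' x.
-/
theorem chromaticPoly_path_mul :
    PowerSeries.mk (fun n => chromaticPoly R (SimpleGraph.pathGraph n) N) *
      reduced (PowerSeries.mk fun k => MvPolynomial.esymm (Fin N) R k) =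
    PowerSeries.mk fun k => MvPolynomial.esymm (Fin N) R k := by
  classical
  set x : (MvPolynomial (Fin N) R)⟦X⟧ :=
    PowerSeries.mk (fun n => chromaticPoly R (SimpleGraph.pathGraph n) N)
  set f : Fin N → (MvPolynomial (Fin N) R)⟦X⟧ := fun i => 1 + C (MvPolynomial.X i) * X with hf
  have hE : PowerSeries.mk (fun k => MvPolynomial.esymm (Fin N) R k) = ∏ i, f i := by
    ext1 k
    rw [coeff_mk, coeff_prod_one_add_C_mul_X]
  have hy : ∀ i, PowerSeries.mk (pathPolyFrom R N i) * f i =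
      C (MvPolynomial.X i) * X * x := by
    intro i
    have : PowerSeries.mk (pathPolyFrom R N i) =
        X * (C (MvPolynomial.X i) * (x - PowerSeries.mk (pathPolyFrom R N i))) := by
      ext1 n
      cases n with
      | zero => simp [pathPolyFrom_zero]
      | succ n =>
        rw [coeff_succ_X_mul, coeff_C_mul, map_sub, coeff_mk, coeff_mk, coeff_mk,
          pathPolyFrom_succ]
    rw [hf]
    linear_combination this
  have hx : x = 1 + ∑ i, PowerSeries.mk (pathPolyFrom R N i) := by
    ext1 n
    rw [map_add, map_sum, coeff_one]
    simp only [x, coeff_mk]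
    cases n with
    | zero => simp [chromaticPoly_path_zero, pathPolyFrom_zero]
    | succ n => simp [chromaticPoly_path_succ]
  have hD : derivative _ (∏ i, f i) =
      ∑ i, (∏ j ∈ Finset.univ.erase i, f j) * C (MvPolynomial.X i) := by
    rw [derivative_prod]
    simp [hf]
  rw [hE, reduced, hD]
  have hsum : (x - 1) * ∏ i, f i =
      X * (∑ i, (∏ j ∈ Finset.univ.erase i, f j) * C (MvPolynomial.X i)) * x := by
    rw [hx, add_sub_cancel_left, Finset.sum_mul, Finset.mul_sum, ← hx, Finset.sum_mul]
    refine Finset.sum_congr rfl fun i _ => ?_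
    rw [← Finset.mul_prod_erase _ _ (Finset.mem_univ i)]
    linear_combination (∏ j ∈ Finset.univ.erase i, f j) * hy i
  linear_combination hsum

end Path

/-! ### Algebraic independence and uniqueness of the decomposition -/

section Uniqueness

variable {R : Type*} [CommRing R]

theorem exists_isSymmetric_of_truncation (N : ℕ) (f : Sym R) :
    ∃ p : MvPolynomial (Fin N) R, p.IsSymmetric ∧
      (p : MvPowerSeries (Fin N) R) = truncation R N f := by
  classical
  obtain ⟨⟨M, hM⟩, hf⟩ := f.2
  have hfin := Finsupp.finite_of_degree_le (σ := Fin N) M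
  set p : MvPolynomial (Fin N) R :=
    ∑ d ∈ hfin.toFinset, MvPolynomial.monomial d (MvPowerSeries.coeff d (truncation R N f)) with hp
  have hcoe : (p : MvPowerSeries (Fin N) R) = truncation R N f := by
    ext d
    rw [MvPolynomial.coeff_coe, hp, MvPolynomial.coeff_sum]
    simp only [MvPolynomial.coeff_monomial]
    rw [Finset.sum_ite_eq', ite_eq_left_iff]
    intro hd
    symm
    by_contra h
    rw [coeff_truncation] at h
    have := hM _ h
    rw [Finsupp.embDomain_eq_mapDomain, Finsupp.degree_mapDomain] at this
    exact hd (by simpa using this)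
  refine ⟨p, fun σ => MvPolynomial.coe_injective _ _ ?_, hcoe⟩
  rw [← MvPowerSeries.rename_coe, hcoe]
  ext d
  obtain ⟨d', rfl⟩ : ∃ d' : Fin N →₀ ℕ, d'.embDomain σ.toEmbedding = d :=
    ⟨d.mapDomain σ.symm, by
      rw [Finsupp.embDomain_eq_mapDomain, ← Finsupp.mapDomain_comp]
      simp⟩
  -- `π` extends `σ` by the identity, so the symmetry of `f` under `π` passes to its truncation.
  set π : Equiv.Perm ℕ := σ.viaEmbedding Fin.valEmbedding
  have hπ : (d'.embDomain σ.toEmbedding).embDomain Fin.valEmbedding =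
      (d'.embDomain Fin.valEmbedding).embDomain π.toEmbedding := by
    simp only [Finsupp.embDomain_eq_mapDomain, ← Finsupp.mapDomain_comp]
    congr 1
    funext i
    exact (Equiv.Perm.viaEmbedding_apply σ Fin.valEmbedding i).symm
  have h1 := MvPowerSeries.coeff_embDomain_rename σ.toEmbedding (truncation R N f) d'
  have h2 := MvPowerSeries.coeff_embDomain_rename π.toEmbedding f.1 (d'.embDomain Fin.valEmbedding)
  have h3 : MvPowerSeries.rename π.toEmbedding f.1 = f.1 := hf π
  refine h1.trans ?_
  rw [coeff_truncation, coeff_truncation, hπ, ← h2, h3]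

/-- Substitution of the elementary symmetric polynomials in `N` variables. -/
def esymmSubst (R : Type*) [CommRing R] (N : ℕ) :
    MvPolynomial (Fin N) R →ₐ[R] MvPowerSeries (Fin N) R :=
  (MvPolynomial.coeToMvPowerSeries.algHom R).comp
    ((MvPolynomial.symmetricSubalgebra (Fin N) R).val.comp (MvPolynomial.esymmAlgHom (Fin N) R N))

theorem esymmSubst_apply (N : ℕ) (p : MvPolynomial (Fin N) R) : esymmSubst R N p =
    ((MvPolynomial.esymmAlgHom (Fin N) R N p).1 : MvPowerSeries (Fin N) R) := by
  simp [esymmSubst]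

theorem esymmSubst_injective (N : ℕ) : Function.Injective (esymmSubst R N) := by
  intro p q h
  rw [esymmSubst_apply, esymmSubst_apply] at h
  exact (MvPolynomial.esymmAlgHom_fin_bijective R N).1
    (Subtype.ext (MvPolynomial.coe_injective _ _ h))

theorem exists_esymmSubst_eq (N : ℕ) (f : Sym R) : ∃ p, esymmSubst R N p = truncation R N f := by
  obtain ⟨p, hp, hf⟩ := exists_isSymmetric_of_truncation N f
  obtain ⟨q, hq⟩ := (MvPolynomial.esymmAlgHom_fin_bijective R N).2 ⟨p, hp⟩
  exact ⟨q, by rw [esymmSubst_apply, hq, hf]⟩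

theorem esymmSubst_X (N : ℕ) (i : Fin N) :
    esymmSubst R N (MvPolynomial.X i) = truncation R N (e R (i + 1)) := by
  rw [esymmSubst_apply, MvPolynomial.esymmAlgHom_apply, MvPolynomial.aeval_X, truncation_e]

/-- Setting the first variable equal to `0`. -/
def killFirst (R : Type*) [CommRing R] (N : ℕ) :
    MvPolynomial (Fin N) R →ₐ[R] MvPolynomial (Fin N) R :=
  MvPolynomial.aeval fun i => if (i : ℕ) = 0 then 0 else MvPolynomial.X i

/-- The polynomials fixed by `killFirst` form a subalgebra containing the variable of each e_k with
1 < k ≤ N; the bound `n ≤ N` provides a variable for every part that occurs. -/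
theorem HasNoE1.exists_esymmSubst_eq {n N : ℕ} (hN : n ≤ N) {f : Sym R} (hf : HasNoE1 n f) :
    ∃ p, esymmSubst R N p = truncation R N f ∧ killFirst R N p = p := by
  set W := (AlgHom.equalizer (killFirst R N) (AlgHom.id R _)).map (esymmSubst R N)
  suffices h : truncation R N f ∈ W by
    obtain ⟨p, hp, hpf⟩ := h
    exact ⟨p, hpf, hp⟩
  obtain ⟨c, rfl, hc⟩ := hf
  rw [map_sum]
  refine Subalgebra.sum_mem _ fun lam _ => ?_
  by_cases h1 : 1 ∈ lam.parts
  · rw [hc lam h1, zero_smul, map_zero]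
    exact Subalgebra.zero_mem _
  · rw [map_smul, ePart, map_multiset_prod, Multiset.map_map]
    refine Subalgebra.smul_mem _ (Subalgebra.multiset_prod_mem _ fun y hy => ?_) _
    obtain ⟨k, hk, rfl⟩ := Multiset.mem_map.1 hy
    have hk0 := lam.parts_pos hk
    have hk1 : k ≠ 1 := by
      rintro rfl
      exact h1 hk
    have hkn : k ≤ n := by
      rw [← lam.parts_sum]
      exact Multiset.le_sum_of_mem hk
    refine ⟨MvPolynomial.X ⟨k - 1, by omega⟩, ?_, ?_⟩
    · change killFirst R N _ = _
      rw [killFirst, MvPolynomial.aeval_X, if_neg (by simp; omega)]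
      rfl
    · change esymmSubst R N _ = _
      rw [esymmSubst_X]
      simp only [Function.comp_apply]
      rw [Nat.sub_add_cancel hk0]

/-- In the polynomial ring on the e_k, `killFirst` fixes the polynomial of `g` but annihilates that
of e_1 f, so both vanish. -/
theorem eq_zero_of_e_one_mul_eq [IsDomain R] {n : ℕ} {f g : Sym R} (hg : HasNoE1 n g)
    (h : e R 1 * f = g) : f = 0 ∧ g = 0 := by
  have key : ∀ N, n + 1 ≤ N → truncation R N f = 0 ∧ truncation R N g = 0 := by
    intro N hN
    obtain ⟨p, hp⟩ := PathAnalog.exists_esymmSubst_eq N f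
    obtain ⟨q, hq, hkill⟩ := hg.exists_esymmSubst_eq (N := N) (by omega)
    have hX := esymmSubst_X (R := R) N ⟨0, by omega⟩
    have h' : MvPolynomial.X ⟨0, by omega⟩ * p = q := by
      refine esymmSubst_injective N ?_
      rw [map_mul, hX, hp, hq, ← h, map_mul]
    have hq0 : q = 0 := by
      rw [← hkill, ← h', map_mul, killFirst, MvPolynomial.aeval_X, if_pos rfl, zero_mul]
    have hp0 : p = 0 := by
      rw [hq0] at h'
      exact (mul_eq_zero.1 h').resolve_left (MvPolynomial.X_ne_zero _)
    rw [← hp, ← hq, hp0, hq0, map_zero]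
    exact ⟨rfl, rfl⟩
  exact ⟨eq_zero_of_truncation _ fun N hN => (key N hN).1,
    eq_zero_of_truncation _ fun N hN => (key N hN).2⟩

theorem HasNoE1.sub {n : ℕ} {f g : Sym R} (hf : HasNoE1 n f) (hg : HasNoE1 n g) :
    HasNoE1 n (f - g) := by
  obtain ⟨c, rfl, hc⟩ := hf
  obtain ⟨d, rfl, hd⟩ := hg
  refine ⟨fun lam => c lam - d lam, ?_, fun lam h => by
    simp only [hc lam h, hd lam h, sub_zero]⟩
  simp only [sub_smul, Finset.sum_sub_distrib]

theorem IsPathDecomposition.unique [IsDomain R] {n : ℕ} {A B A' B' : Sym R}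
    (h : IsPathDecomposition n A B) (h' : IsPathDecomposition n A' B') : A = A' ∧ B = B' := by
  have := eq_zero_of_e_one_mul_eq (f := A - A') (h'.2.sub h.2)
    (by linear_combination h'.1 - h.1)
  exact ⟨sub_eq_zero.1 this.1, (sub_eq_zero.1 this.2).symm⟩

end Uniqueness

/-! ### The series of A_n and B_n, and change of coefficients -/

section Existence

variable (R : Type*) [CommRing R]

theorem coeff_zero_reduced {A : Type*} [CommRing A] (E : A⟦X⟧) :
    coeff 0 (reduced E) = coeff 0 E := by
  simp [reduced]

theorem coeff_succ_reduced {A : Type*} [CommRing A] (E : A⟦X⟧) (n : ℕ) :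
    coeff (n + 1) (reduced E) = -(n : A) * coeff (n + 1) E := by
  rw [reduced, map_sub, coeff_succ_X_mul, coeff_derivative]
  ring

theorem map_reduced {A A' : Type*} [CommRing A] [CommRing A'] (φ : A →+* A') (E : A⟦X⟧) :
    PowerSeries.map φ (reduced E) = reduced (PowerSeries.map φ E) := by
  ext n
  rw [coeff_map]
  cases n with
  | zero => rw [coeff_zero_reduced, coeff_zero_reduced, coeff_map]
  | succ n => rw [coeff_succ_reduced, coeff_succ_reduced, coeff_map, map_mul, map_neg, map_natCast]

theorem e_zero : e R 0 = 1 := by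
  rw [← sub_eq_zero]
  refine eq_zero_of_truncation 0 fun N _ => ?_
  rw [map_sub, truncation_e, MvPolynomial.esymm_zero, map_one]
  simp

/-- The generating function of the elementary symmetric functions. -/
def eSeries : (Sym R)⟦X⟧ := PowerSeries.mk (e R)

theorem constantCoeff_eSeries : constantCoeff (eSeries R) = 1 := by
  simp [eSeries, e_zero]

theorem constantCoeff_reduced_eSeries : constantCoeff (reduced (eSeries R)) = 1 := by
  rw [← coeff_zero_eq_constantCoeff_apply, coeff_zero_reduced, coeff_zero_eq_constantCoeff_apply,
    constantCoeff_eSeries]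

theorem pathX_series_mul : PowerSeries.mk (pathX R) * reduced (eSeries R) = eSeries R := by
  ext1 n
  rw [← sub_eq_zero]
  refine eq_zero_of_truncation 0 fun N _ => ?_
  have h := congrArg (PowerSeries.map MvPolynomial.coeToMvPowerSeries.ringHom)
    (chromaticPoly_path_mul R N)
  have hE : PowerSeries.map (truncation R N).toRingHom (eSeries R) =
      PowerSeries.map MvPolynomial.coeToMvPowerSeries.ringHom
        (PowerSeries.mk fun k => MvPolynomial.esymm (Fin N) R k) := by
    ext1 k
    simp only [eSeries, coeff_map, coeff_mk]
    exact truncation_e N k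
  have hx : PowerSeries.map (truncation R N).toRingHom (PowerSeries.mk (pathX R)) =
      PowerSeries.map MvPolynomial.coeToMvPowerSeries.ringHom
        (PowerSeries.mk fun n => chromaticPoly R (SimpleGraph.pathGraph n) N) := by
    ext1 k
    simp only [coeff_map, coeff_mk]
    exact truncation_chromaticSym _ N
  rw [map_mul, map_reduced, ← hE, ← hx, ← map_reduced, ← map_mul] at h
  rw [map_sub, sub_eq_zero]
  have := congrArg (coeff n) h
  rwa [coeff_map, coeff_map] at this

/-- The generating function of the functions `A_n`. -/
def aSeries : (Sym R)⟦X⟧ := invOfUnit (reduced (eSeries R)) 1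

theorem reduced_mul_aSeries : reduced (eSeries R) * aSeries R = 1 :=
  mul_invOfUnit _ _ (by rw [constantCoeff_reduced_eSeries, Units.val_one])

theorem coeff_zero_aSeries : coeff 0 (aSeries R) = 1 := by
  simp [aSeries]

/-- Compare coefficients in (E - XE')A = 1. The factor `i` removes e_1, and the recursion is the one
obtained by splitting off the first part of a composition in Ã. -/
theorem coeff_succ_aSeries (n : ℕ) : coeff (n + 1) (aSeries R) =
    ∑ i ∈ Finset.range (n + 1), (i : Sym R) * e R (i + 1) * coeff (n - i) (aSeries R) := by
  have h := congrArg (coeff (n + 1)) (reduced_mul_aSeries R)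
  rw [coeff_mul, Finset.Nat.sum_antidiagonal_eq_sum_range_succ_mk, Finset.sum_range_succ',
    coeff_zero_reduced, coeff_one, if_neg (Nat.succ_ne_zero n)] at h
  simp only [coeff_succ_reduced, eSeries, coeff_mk, e_zero, Nat.add_sub_add_right,
    tsub_zero, one_mul] at h
  rw [eq_neg_of_add_eq_zero_right h, ← Finset.sum_neg_distrib]
  refine Finset.sum_congr rfl fun i _ => ?_
  ring

/-- The generating function of the functions `B_n`. -/
def bSeries : (Sym R)⟦X⟧ := (eSeries R - C (e R 1) * X) * aSeries R

variable {R}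

theorem hasNoE1_zero (n : ℕ) : HasNoE1 n (0 : Sym R) :=
  ⟨0, by simp, fun _ _ => rfl⟩

theorem HasNoE1.add {n : ℕ} {f g : Sym R} (hf : HasNoE1 n f) (hg : HasNoE1 n g) :
    HasNoE1 n (f + g) := by
  simpa using hf.sub ((hasNoE1_zero n).sub hg)

theorem HasNoE1.smul {n : ℕ} {f : Sym R} (hf : HasNoE1 n f) (r : R) : HasNoE1 n (r • f) := by
  obtain ⟨c, rfl, hc⟩ := hf
  refine ⟨fun lam => r * c lam, ?_, fun lam h => by simp only [hc lam h, mul_zero]⟩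
  simp only [Finset.smul_sum, mul_smul]

theorem HasNoE1.sum {ι : Type*} {n : ℕ} (s : Finset ι) (f : ι → Sym R)
    (h : ∀ i ∈ s, HasNoE1 n (f i)) : HasNoE1 n (∑ i ∈ s, f i) := by
  classical
  induction s using Finset.induction_on with
  | empty => exact hasNoE1_zero n
  | insert a s ha ih =>
    rw [Finset.sum_insert ha]
    exact (h a (by simp)).add (ih fun i hi => h i (by simp [hi]))

theorem hasNoE1_ePart {n : ℕ} (lam : n.Partition) (h : 1 ∉ lam.parts) :
    HasNoE1 n (ePart R lam) := by
  classical
  refine ⟨Pi.single lam 1, ?_, fun mu hmu => Pi.single_eq_of_ne ?_ _⟩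
  · rw [Finset.sum_eq_single_of_mem lam (Finset.mem_univ _)]
    · simp
    · intro mu _ hne
      rw [Pi.single_eq_of_ne hne, zero_smul]
  · rintro rfl
    exact h hmu

theorem hasNoE1_one : HasNoE1 0 (1 : Sym R) := by
  have h := hasNoE1_ePart (R := R) (⟨0, by simp, by simp⟩ : Nat.Partition 0) (by simp)
  simpa [ePart] using h

theorem HasNoE1.e_mul {m n k : ℕ} {f : Sym R} (hf : HasNoE1 n f) (hk : k ≠ 1)
    (hm : k + n = m) : HasNoE1 m (e R k * f) := by
  subst hm
  by_cases hk0 : k = 0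
  · subst hk0
    rwa [e_zero, one_mul, zero_add]
  obtain ⟨c, rfl, hc⟩ := hf
  rw [Finset.mul_sum]
  refine HasNoE1.sum _ _ fun lam _ => ?_
  rw [mul_smul_comm]
  by_cases h1 : 1 ∈ lam.parts
  · rw [hc lam h1, zero_smul]
    exact hasNoE1_zero _
  · have h := hasNoE1_ePart (R := R) (⟨k ::ₘ lam.parts, by
      intro i hi
      rcases Multiset.mem_cons.1 hi with rfl | hi
      · omega
      · exact lam.parts_pos hi, by rw [Multiset.sum_cons, lam.parts_sum]⟩ : (k + n).Partition)
      (by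
        rw [Multiset.mem_cons, not_or]
        exact ⟨Ne.symm hk, h1⟩)
    rw [ePart, Multiset.map_cons, Multiset.prod_cons] at h
    exact h.smul _

theorem hasNoE1_coeff_aSeries (n : ℕ) : HasNoE1 n (coeff n (aSeries R)) := by
  induction n using Nat.strong_induction_on with
  | _ n ih =>
    cases n with
    | zero =>
      rw [coeff_zero_aSeries]
      exact hasNoE1_one
    | succ n =>
      rw [coeff_succ_aSeries]
      refine HasNoE1.sum _ _ fun i hi => ?_
      rw [Finset.mem_range] at hi
      rcases i with _ | i
      · simpa using hasNoE1_zero (n + 1)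
      · have := ((ih (n - (i + 1)) (by omega)).e_mul (k := i + 1 + 1) (m := n + 1) (by omega)
          (by omega)).smul ((i + 1 : ℕ) : R)
        rwa [Algebra.smul_def, map_natCast, ← mul_assoc] at this

theorem hasNoE1_coeff_bSeries (n : ℕ) : HasNoE1 n (coeff n (bSeries R)) := by
  rw [bSeries, coeff_mul]
  refine HasNoE1.sum _ _ ?_
  rintro ⟨i, j⟩ hij
  rw [Finset.HasAntidiagonal.mem_antidiagonal] at hij
  simp only at hij ⊢
  rw [map_sub, coeff_C_mul, coeff_X, eSeries, coeff_mk]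
  -- The term e_1 X subtracted from E cancels precisely the factor of index 1.
  split_ifs with hi
  · subst hi
    simpa using hasNoE1_zero n
  · simpa using (hasNoE1_coeff_aSeries j).e_mul hi hij

theorem isPathDecomposition_coeff (n : ℕ) :
    IsPathDecomposition n (coeff n (aSeries R)) (coeff (n + 1) (bSeries R)) := by
  refine ⟨?_, hasNoE1_coeff_bSeries (n + 1)⟩
  have h : PowerSeries.mk (pathX R) = X * (C (e R 1) * aSeries R) + bSeries R := by
    rw [bSeries]
    linear_combination aSeries R * pathX_series_mul R -
      PowerSeries.mk (pathX R) * reduced_mul_aSeries R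
  have := congrArg (coeff (n + 1)) h
  rwa [coeff_mk, map_add, coeff_succ_X_mul, coeff_C_mul] at this

/-- `Sym.map` as a ring homomorphism. -/
def symMapHom {S : Type*} [CommRing S] (φ : R →+* S) : Sym R →+* Sym S where
  toFun := Sym.map φ
  map_one' := Subtype.ext (map_one (MvPowerSeries.map φ))
  map_mul' f g := Subtype.ext (map_mul (MvPowerSeries.map φ) f.1 g.1)
  map_zero' := Subtype.ext (map_zero (MvPowerSeries.map φ))
  map_add' f g := Subtype.ext (map_add (MvPowerSeries.map φ) f.1 g.1)

theorem symMapHom_e {S : Type*} [CommRing S] (φ : R →+* S) (k : ℕ) :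
    symMapHom φ (e R k) = e S k := by
  classical
  refine Subtype.ext (MvPowerSeries.ext fun d => ?_)
  change φ (if d.degree = k ∧ ∀ i, d i ≤ 1 then 1 else 0) =
    if d.degree = k ∧ ∀ i, d i ≤ 1 then 1 else 0
  split_ifs <;> simp

theorem map_eSeries {S : Type*} [CommRing S] (φ : R →+* S) :
    PowerSeries.map (symMapHom φ) (eSeries R) = eSeries S := by
  ext1 k
  rw [coeff_map, eSeries, eSeries, coeff_mk, coeff_mk, symMapHom_e]

theorem map_aSeries {S : Type*} [CommRing S] (φ : R →+* S) :
    PowerSeries.map (symMapHom φ) (aSeries R) = aSeries S := by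
  have h := congrArg (PowerSeries.map (symMapHom φ)) (reduced_mul_aSeries R)
  rw [map_mul, map_reduced, map_eSeries, map_one] at h
  linear_combination aSeries S * h - PowerSeries.map (symMapHom φ) (aSeries R) *
    reduced_mul_aSeries S

theorem map_bSeries {S : Type*} [CommRing S] (φ : R →+* S) :
    PowerSeries.map (symMapHom φ) (bSeries R) = bSeries S := by
  rw [bSeries, map_mul, map_sub, map_mul, map_C, map_X, map_eSeries, map_aSeries, symMapHom_e,
    bSeries]

end Existence

/-! ### Commutative images of ribbons, Ã and B̃ -/

section Projection

variable (K : Type*) [Field K]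

theorem rho_Lam (k : ℕ) : rho K (Lam K k) = e K k := by
  rw [Lam]
  split_ifs with h
  · exact FreeAlgebra.lift_ι_apply (R := K) (fun k : ℕ+ => e K (k : ℕ)) _
  · obtain rfl : k = 0 := by omega
    rw [map_one, e_zero]

/-- The inverse of the generating function of the elementary symmetric functions. -/
def eInv : (Sym K)⟦X⟧ := invOfUnit (eSeries K) 1

theorem eSeries_mul_eInv : eSeries K * eInv K = 1 :=
  mul_invOfUnit _ _ (by rw [constantCoeff_eSeries, Units.val_one])

theorem rho_S (k : ℕ) : rho K (S K k) = (-1) ^ k * coeff k (eInv K) := by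
  set L : (NSym K)⟦X⟧ := PowerSeries.mk fun j => (-1 : NSym K) ^ j * Lam K j with hL
  have h : L * invOfUnit L 1 = 1 := mul_invOfUnit _ _ (by simp [hL, Lam])
  have h1 := congrArg (PowerSeries.map (rho K).toRingHom) h
  rw [map_mul, map_one] at h1
  have h2 : PowerSeries.map (rho K).toRingHom L = rescale (-1) (eSeries K) := by
    ext1 j
    simp only [hL, coeff_map, coeff_mk, eSeries, coeff_rescale]
    change rho K _ = _
    rw [map_mul, map_pow, map_neg, map_one, rho_Lam]
  have h3 : rescale (-1) (eSeries K) * rescale (-1) (eInv K) = 1 := by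
    rw [← map_mul, eSeries_mul_eInv, map_one]
  rw [h2] at h1
  have h4 : PowerSeries.map (rho K).toRingHom (invOfUnit L 1) = rescale (-1) (eInv K) := by
    linear_combination rescale (-1) (eInv K) * h1 -
      PowerSeries.map (rho K).toRingHom (invOfUnit L 1) * h3
  have := congrArg (coeff k) h4
  rwa [coeff_map, coeff_rescale] at this

/-- The signed complete symmetric functions `(-1)^(k-1) h_k`. -/
def signedH (k : ℕ) : Sym K := -coeff k (eInv K)

/-- The sign ε splits as (-1)^(j-1) per part, and ρ(S_j) carries (-1)^j, so each part contributes
-[X^j] 1/E. -/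
theorem prod_signedH (l : List ℕ) (hl : ∀ i ∈ l, 0 < i) :
    (-1 : K) ^ (l.sum - l.length) • rho K (l.map (S K)).prod = (l.map (signedH K)).prod := by
  induction l with
  | nil => simp
  | cons a l ih =>
    have hl' : ∀ i ∈ l, 0 < i := fun i hi => hl i (by simp [hi])
    have ha : 0 < a := hl a (by simp)
    have hle : l.length ≤ l.sum := by
      simpa using List.card_nsmul_le_sum l 1 hl'
    obtain ⟨a, rfl⟩ := Nat.exists_eq_succ_of_ne_zero ha.ne'
    have h : a + 1 + l.sum - (l.length + 1) = a + (l.sum - l.length) := by omega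
    rw [List.map_cons, List.map_cons, List.prod_cons, List.prod_cons, map_mul, ← ih hl',
      List.sum_cons, List.length_cons, rho_S, signedH, Nat.succ_eq_add_one, h, pow_add]
    simp only [Algebra.smul_def, map_mul, map_pow, map_neg, map_one]
    have h1 : ((-1 : Sym K) ^ a) * (-1) ^ a = 1 := by
      rw [← mul_pow, show (-1 : Sym K) * -1 = 1 by ring, one_pow]
    rw [pow_succ]
    linear_combination (-coeff (a + 1) (eInv K) *
      ((-1) ^ (l.sum - l.length) * rho K (l.map (S K)).prod)) * h1

theorem rho_ribbon {n : ℕ} (I : Composition n) {a : ℕ} {l : List ℕ} (h : I.blocks = a :: l) :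
    rho K (ribbon K I) = sgn K I • coarseSum (signedH K) a l := by
  classical
  have hpos : ∀ i ∈ a :: l, 0 < i := fun i hi => I.blocks_pos (h ▸ hi)
  have hn : n = a + l.sum := by rw [← I.blocks_sum, h, List.sum_cons]
  rw [ribbon, map_smul, map_sum]
  congr 1
  rw [← sum_coarsenings _ a l (hpos a (by simp)) (fun i hi => hpos i (by simp [hi])), ← hn,
    Finset.sum_filter, Finset.sum_filter, ← sum_composition]
  refine Finset.sum_congr rfl fun J _ => ?_
  simp only [boundaries_subset_iff, h]
  refine if_congr Iff.rfl ?_ rfl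
  rw [map_smul, ← prod_signedH K _ fun i hi => J.blocks_pos hi, J.blocks_sum, SC, sgn,
    J.blocks_length]

theorem sum_compLists_prefix {M : Type*} [AddCommMonoid M] (a b n : ℕ) (ha : 0 < a) (hb : 0 < b)
    (f : List ℕ → M) :
    ∑ l ∈ compLists (a + b + n) with [a, b] <+: l, f l = ∑ l ∈ compLists n, f (a :: b :: l) := by
  symm
  refine Finset.sum_bij (fun l _ => a :: b :: l) ?_ ?_ ?_ ?_
  · intro l hl
    rw [mem_compLists] at hl
    simp only [Finset.mem_filter, mem_compLists, List.mem_cons, forall_eq_or_imp, List.sum_cons]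
    exact ⟨⟨⟨ha, hb, hl.1⟩, by omega⟩, l, rfl⟩
  · intro l _ l' _ h
    simpa using h
  · intro l hl
    simp only [Finset.mem_filter, mem_compLists] at hl
    obtain ⟨⟨hpos, hsum⟩, t, rfl⟩ := hl
    refine ⟨t, mem_compLists.2 ⟨fun i hi => hpos i (by simp [hi]), ?_⟩, rfl⟩
    simp only [List.cons_append, List.nil_append, List.sum_cons] at hsum
    omega
  · intros
    rfl

theorem rho_ribbonSum (a b n : ℕ) (ha : 0 < a) (hb : 0 < b) :
    rho K (ribbonSum K (a + b + n) [a, b]) =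
      ∑ l ∈ compLists n, weight (Sym K) (a :: b :: l) * coarseSum (signedH K) a (b :: l) := by
  classical
  rw [ribbonSum, map_sum, Finset.sum_filter]
  have h : ∀ I : Composition (a + b + n),
      (if InC I ∧ [a, b] <+: I.blocks then rho K (mC K I • ribbon K I) else 0) =
      if [a, b] <+: I.blocks then
        weight (Sym K) I.blocks * coarseSum (signedH K) I.blocks.head! I.blocks.tail else 0 := by
    intro I
    by_cases hp : [a, b] <+: I.blocks
    · obtain ⟨l, hl⟩ := id hp
      have hl' : I.blocks = a :: (b :: l) := hl.symm
      rw [if_pos hp, weight_eq _ fun i hi => I.blocks_pos hi]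
      simp only [hp, and_true, InC]
      split_ifs
      · rw [map_smul, rho_ribbon K I hl', mC, sgn, I.blocks_sum, I.blocks_length, smul_smul,
          Algebra.smul_def, hl', map_mul, map_pow, map_pow, map_neg, map_one, map_ofNat]
        rfl
      · rw [zero_mul]
    · simp [hp]
  rw [Finset.sum_congr rfl fun I _ => h I]
  refine (sum_composition (a + b + n) (fun l => if [a, b] <+: l then
    weight (Sym K) l * coarseSum (signedH K) l.head! l.tail else 0)).trans ?_
  rw [← Finset.sum_filter, sum_compLists_prefix a b n ha hb]
  rfl

theorem ribbonSum_eq_zero (n : ℕ) (p : List ℕ) (h : n < p.sum) : ribbonSum K n p = 0 := by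
  classical
  rw [ribbonSum]
  refine Finset.sum_eq_zero fun I hI => ?_
  exfalso
  rw [Finset.mem_filter] at hI
  obtain ⟨-, -, t, ht⟩ := hI
  have := congrArg List.sum ht
  rw [List.sum_append, I.blocks_sum] at this
  omega

/-- The prefix 12 has weight 2·(-1). The empty remainder, possible for `n = 0`, has weight 0, since
12 does not end in 1. -/
theorem rho_ribbonSum_one_two (n : ℕ) : rho K (ribbonSum K (n + 3) [1, 2]) =
    -(2 * (signedH K 1 * weightedSum (signedH K) 2 n + weightedSum (signedH K) 3 n)) := by
  rw [show n + 3 = 1 + 2 + n by omega, rho_ribbonSum K 1 2 n (by omega) (by omega),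
    ← sum_weight_cons (signedH K) 1 2, Finset.mul_sum, ← Finset.sum_neg_distrib]
  refine Finset.sum_congr rfl fun l _ => ?_
  simp only [weight, if_true, reduceCtorEq, if_false, OfNat.ofNat_ne_one]
  ring

/-- The prefix 11 has weight 2·2. Total at least 3 excludes the bare composition 11, which
`weightedSum` would miss. -/
theorem rho_ribbonSum_one_one (n : ℕ) : rho K (ribbonSum K (n + 3) [1, 1]) =
    4 * (signedH K 1 * weightedSum (signedH K) 1 (n + 1) +
      weightedSum (signedH K) 2 (n + 1)) := by
  rw [show n + 3 = 1 + 1 + (n + 1) by omega, rho_ribbonSum K 1 1 (n + 1) (by omega) (by omega),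
    ← sum_weight_cons (signedH K) 1 1, Finset.mul_sum]
  refine Finset.sum_congr rfl fun l hl => ?_
  simp only [weight, if_true, ne_nil_of_mem_compLists_succ hl, if_false, reduceCtorEq]
  ring

theorem weightedSeries_signedH :
    3 * (X * C (signedH K 1) * weightedSeries (signedH K) 1 + weightedSeries (signedH K) 2) -
      2 * (X * C (signedH K 1) * weightedSeries (signedH K) 2 + weightedSeries (signedH K) 3) =
    2 * (bSeries K - 1) - 4 * C (e K 2) * X ^ 2 := by
  rw [weightedSeries_combination (signedH K) (constantCoeff_eSeries K) (eSeries_mul_eInv K)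
    (reduced_mul_aSeries K) (fun _ => rfl)]
  have h := reduced_mul_aSeries K
  have h1 : coeff 1 (eSeries K) = e K 1 := coeff_mk _ _
  have h2 : coeff 2 (eSeries K) = e K 2 := coeff_mk _ _
  rw [h1, h2, bSeries]
  rw [reduced] at h
  -- (E - XE')A = 1 turns (XE' - e_1 X)A into B - 1.
  linear_combination -2 * h

theorem rho_Atilde (n : ℕ) : rho K (Atilde K n) = coeff n (aSeries K) := by
  have hsum : rho K (Atilde K n) = ∑ l ∈ compLists n,
      (l.map fun i : ℕ => ((i : Sym K) - 1) * e K i).prod := by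
    rw [Atilde, map_sum, ← sum_composition]
    refine Finset.sum_congr rfl fun I _ => ?_
    rw [map_smul, LamC, map_list_prod, List.map_map, Algebra.smul_def, map_list_prod, List.map_map,
      List.prod_map_mul]
    congr 3
    · funext i
      simp
    · funext i
      exact rho_Lam K i
  rw [hsum]
  clear hsum
  induction n using Nat.strong_induction_on with
  | _ n ih =>
    cases n with
    | zero => simp [compLists_zero, coeff_zero_aSeries]
    | succ n =>
      rw [coeff_succ_aSeries, sum_compLists_succ]
      refine Finset.sum_congr rfl fun i _ => ?_
      rw [← ih (n - i) (by omega), Finset.mul_sum]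
      refine Finset.sum_congr rfl fun l _ => ?_
      rw [List.map_cons, List.prod_cons]
      push_cast
      ring

theorem rho_Btilde [CharZero K] (n : ℕ) : rho K (Btilde K (n + 3)) = coeff (n + 3) (bSeries K) := by
  have h := congrArg (coeff (n + 3)) (weightedSeries_signedH K)
  have c2 : (2 : (Sym K)⟦X⟧) = C 2 := (map_ofNat C 2).symm
  have c3 : (3 : (Sym K)⟦X⟧) = C 3 := (map_ofNat C 3).symm
  have c4 : (4 : (Sym K)⟦X⟧) = C 4 := (map_ofNat C 4).symm
  rw [c2, c3, c4, mul_assoc X, mul_assoc X, mul_assoc (C 4)] at h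
  simp only [map_add, map_sub, coeff_C_mul, weightedSeries, coeff_succ_X_mul,
    coeff_X_pow_mul', coeff_mk, coeff_one, coeff_X_pow] at h
  simp only [show 3 ≤ n + 3 by omega, show 2 ≤ n + 3 by omega, show 2 ≤ n + 2 by omega,
    show 1 ≤ n + 2 by omega, if_true, Nat.add_sub_cancel, show n + 2 - 1 = n + 1 by omega,
    show n + 3 - 2 = n + 1 by omega, show n + 3 ≠ 0 by omega, show n + 3 ≠ 2 by omega, if_false,
    mul_zero, sub_zero] at h
  have h' : coeff (n + 3) (bSeries K) = (1 / 2 : K) • (2 * coeff (n + 3) (bSeries K)) := by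
    rw [← smul_mul_assoc, Algebra.smul_def, ← map_ofNat (algebraMap K (Sym K)) 2, ← map_mul]
    norm_num
  -- In these degrees 2B is the combination with coefficients 3 and -2. Half of it matches (3/8)·4 =
  -- (1/2)·3 for the prefix 11 and (1/2)·(-2) for the prefix 12.
  rw [h', ← h, Btilde, map_add, map_smul, map_smul, rho_ribbonSum_one_two, rho_ribbonSum_one_one,
    show (3 / 8 : K) = (1 / 2) * (3 / 4) by norm_num, mul_smul, ← smul_add]
  congr 1
  have h4 : (3 / 4 : K) • (4 : Sym K) = 3 := by
    rw [Algebra.smul_def, ← map_ofNat (algebraMap K (Sym K)) 4, ← map_mul,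
      ← map_ofNat (algebraMap K (Sym K)) 3]
    norm_num
  rw [← smul_mul_assoc, h4]
  ring

/-- Both sides are zero: no composition of 1 has two parts, and X_{P_1} = e_1. -/
theorem rho_Btilde_one : rho K (Btilde K 1) = coeff 1 (bSeries K) := by
  rw [Btilde, ribbonSum_eq_zero K 1 [1, 2] (by simp), ribbonSum_eq_zero K 1 [1, 1] (by simp),
    bSeries, coeff_mul, Finset.Nat.sum_antidiagonal_eq_sum_range_succ_mk, Finset.sum_range_succ,
    Finset.sum_range_one, coeff_succ_aSeries]
  simp [eSeries]

theorem rho_ribbon_ones_two :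
    rho K ((2 : K) • ribbon K (Composition.ones 2)) = coeff 2 (bSeries K) := by
  obtain ⟨-, h1, h2⟩ := coeff_of_mul_eq_one (constantCoeff_eSeries K) (eSeries_mul_eInv K)
  have he1 : coeff 1 (eSeries K) = e K 1 := coeff_mk _ _
  have he2 : coeff 2 (eSeries K) = e K 2 := coeff_mk _ _
  have hs : sgn K (Composition.ones 2) = 1 := by simp [sgn]
  have hr : rho K (ribbon K (Composition.ones 2)) = e K 2 := by
    rw [rho_ribbon K _ (a := 1) (l := [1]) rfl, hs, one_smul]
    simp only [coarseSum, signedH, Nat.reduceAdd]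
    rw [h1, h2, he1, he2]
    ring
  have ha1 : coeff 1 (aSeries K) = 0 := by
    rw [coeff_succ_aSeries]
    simp
  have ha2 : coeff 2 (aSeries K) = e K 2 := by
    rw [coeff_succ_aSeries, Finset.sum_range_succ, Finset.sum_range_one]
    simp [coeff_zero_aSeries]
  rw [map_smul, hr, bSeries, coeff_mul, Finset.Nat.sum_antidiagonal_eq_sum_range_succ_mk,
    Finset.sum_range_succ, Finset.sum_range_succ, Finset.sum_range_one]
  simp only [map_sub, coeff_C_mul, coeff_X, tsub_zero, Nat.reduceSub, ha1, ha2, he2,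
    coeff_zero_aSeries]
  rw [two_smul]
  simp [eSeries, e_zero]

end Projection

/-! ### Passage from integral coefficients to K -/

section Integral

theorem IsPathDecomposition.eq_coeff {n : ℕ} {A B : Sym ℤ} (h : IsPathDecomposition n A B) :
    A = coeff n (aSeries ℤ) ∧ B = coeff (n + 1) (bSeries ℤ) :=
  h.unique (isPathDecomposition_coeff n)

variable {K : Type*} [CommRing K]

theorem map_coeff_aSeries (n : ℕ) :
    Sym.map (Int.castRingHom K) (coeff n (aSeries ℤ)) = coeff n (aSeries K) := by
  rw [← map_aSeries (Int.castRingHom K), coeff_map]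
  rfl

theorem map_coeff_bSeries (n : ℕ) :
    Sym.map (Int.castRingHom K) (coeff n (bSeries ℤ)) = coeff n (bSeries K) := by
  rw [← map_bSeries (Int.castRingHom K), coeff_map]
  rfl

end Integral

end PathAnalog
end

theorem lemma3p5 (K : Type*) [Field K] [CharZero K] :
    -- the functions `A_n` and `B_{n+1}` over `ℤ` are well defined
    (∀ n : ℕ, ∃! AB : PathAnalog.Sym ℤ × PathAnalog.Sym ℤ,
      PathAnalog.IsPathDecomposition n AB.1 AB.2) ∧
    -- and they have the stated noncommutative analogs
    ∀ A B : ℕ → PathAnalog.Sym ℤ,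
      (∀ n : ℕ, PathAnalog.IsPathDecomposition n (A n) (B (n + 1))) →
      (∀ n : ℕ, PathAnalog.Sym.map (Int.castRingHom K) (A n) =
        PathAnalog.rho K (PathAnalog.Atilde K n)) ∧
      (∀ n : ℕ, 1 ≤ n → n ≠ 2 → PathAnalog.Sym.map (Int.castRingHom K) (B n) =
        PathAnalog.rho K (PathAnalog.Btilde K n)) ∧
      PathAnalog.Sym.map (Int.castRingHom K) (B 2) =
        PathAnalog.rho K ((2 : K) • PathAnalog.ribbon K (Composition.ones 2)) := by
  refine ⟨fun n => ⟨(_, _), PathAnalog.isPathDecomposition_coeff n, fun AB h =>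
    Prod.ext h.eq_coeff.1 h.eq_coeff.2⟩, fun A B h => ⟨fun n => ?_, fun n hn hn2 => ?_, ?_⟩⟩
  · rw [(h n).eq_coeff.1, PathAnalog.map_coeff_aSeries, PathAnalog.rho_Atilde]
  · obtain _ | _ | _ | n := n
    · omega
    · rw [(h 0).eq_coeff.2, PathAnalog.map_coeff_bSeries, PathAnalog.rho_Btilde_one]
    · omega
    · rw [(h (n + 2)).eq_coeff.2, PathAnalog.map_coeff_bSeries, PathAnalog.rho_Btilde]
  · rw [(h 1).eq_coeff.2, PathAnalog.map_coeff_bSeries, PathAnalog.rho_ribbon_ones_two]
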